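/- Let $\alpha,\beta:(0,\infty)\to[0,\infty)$ be piecewise continuous functions (continuous off a set of break points that meets every compact subinterval of $(0,\infty)$ in a finite set) such that the integrals $$\int_0^\infty \alpha(\xi)\,\xi^p\,d\xi\quad(p=2,4,6),\qquad \int_0^\infty \beta(\xi)\,\xi^q\,d\xi\quad(q=\tfrac52,3,5)$$ are positive and finite. For $\eta>0$ let $(\mathcal A_\eta W)(x)=\frac1\eta\int_{x-\eta/2}^{x+\eta/2}W(y)\,dy$. Put $$d_1=\frac{12}{\int_0^\infty\alpha(\xi)\xi^4\,d\xi},\qquad d_2=\frac{12\int_0^\infty\beta(\xi)\xi^3\,d\xi}{\int_0^\infty\alpha(\xi)\xi^4\,d\xi},\qquad W_0(x)=\frac{3d_1}{2d_2}\,\operatorname{sech}^2\!\Big(\tfrac12\sqrt{d_1}\,x\Big).$$ For $\varepsilon>0$ and real-valued $V\in L^2(\mathbb R)$ define, with Bochner integrals in $L^2(\mathbb R)$, $$\mathcal B_\varepsilon V=V+\int_0^\infty\alpha(\xi)\,\xi^2\,\frac{V-\mathcal A_{\varepsilon\xi}^2V}{\varepsilon^2}\,d\xi,\qquad \mathcal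 M_\varepsilon V=2\int_0^\infty\beta(\xi)\,\xi^3\,\mathcal A_{\varepsilon\xi}\big((\mathcal A_{\varepsilon\xi}W_0)(\mathcal A_{\varepsilon\xi}V)\big)\,d\xi,$$ and $\mathcal L_\varepsilon V=\mathcal B_\varepsilon V-\mathcal M_\varepsilon V$. Let $L^2_{\mathrm{even}}(\mathbb R)$ be the space of real-valued $V\in L^2(\mathbb R)$ with $V(-x)=V(x)$ for almost every $x$. Let $(\varepsilon_n)_{n\in\mathbb N}$ be a sequence of positive numbers with $\varepsilon_n\to0$, and let $(V_n)_{n\in\mathbb N}$ be a bounded sequence in $L^2_{\mathrm{even}}(\mathbb R)$. If $\|\mathcal L_{\varepsilon_n}V_n\|_2\to0$ as $n\to\infty$, then $\|V_n\|_2\to0$ as $n\to\infty$. -/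

import Mathlib

open MeasureTheory Set Filter Topology

noncomputable section

namespace Peridynamic

/-- The real Hilbert space `L²(ℝ)`. -/
abbrev L2 : Type := Lp ℝ 2 (volume : Measure ℝ)

/-- `L²_even(ℝ)`: the square-integrable functions with `V (-x) = V x` for almost every `x`. -/
def L2even : Set L2 := {V | ∀ᵐ x : ℝ, (V : ℝ → ℝ) (-x) = (V : ℝ → ℝ) x}

/-- `f` is piecewise continuous on the open half-line `(0, ∞)`: it is continuous there off a set
of break points that meets every compact subinterval of `(0, ∞)` in a finite set. (Nothing is
required at the break points, so stricter conventions are included.) -/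
def PiecewiseContinuous (f : ℝ → ℝ) : Prop :=
  ∃ S : Set ℝ, (∀ a b : ℝ, 0 < a → (S ∩ Icc a b).Finite) ∧
    ∀ ξ : ℝ, 0 < ξ → ξ ∉ S → ContinuousAt f ξ

/-- The integral `∫₀^∞ f(ξ) ξ^p dξ` is positive and finite. -/
def PosFiniteMoment (f : ℝ → ℝ) (p : ℝ) : Prop :=
  IntegrableOn (fun ξ => f ξ * ξ ^ p) (Ioi 0) ∧ 0 < ∫ ξ in Ioi (0 : ℝ), f ξ * ξ ^ p

/-- The conditions on the coefficient functions `α`, `β` in the expansion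
`∂_r Φ(r, ξ) = α(ξ) r + β(ξ) r² + ∂_r ψ(r, ξ)` of the peridynamical force. -/
structure Admissible (α β : ℝ → ℝ) : Prop where
  alpha_piecewise : PiecewiseContinuous α
  beta_piecewise : PiecewiseContinuous β
  alpha_nonneg : ∀ ξ : ℝ, 0 < ξ → 0 ≤ α ξ
  beta_nonneg : ∀ ξ : ℝ, 0 < ξ → 0 ≤ β ξ
  alpha_two : PosFiniteMoment α 2
  alpha_four : PosFiniteMoment α 4
  alpha_six : PosFiniteMoment α 6
  beta_three : PosFiniteMoment β 3
  beta_five_halves : PosFiniteMoment β (5 / 2)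
  beta_five : PosFiniteMoment β 5

/-- `(𝒜_η W)(x) = η⁻¹ ∫_{x-η/2}^{x+η/2} W(y) dy`, on functions. -/
def avg (η : ℝ) (W : ℝ → ℝ) (x : ℝ) : ℝ := η⁻¹ * ∫ y in (x - η / 2)..(x + η / 2), W y

theorem continuous_avg (η : ℝ) {W : ℝ → ℝ} (hW : LocallyIntegrable W) :
    Continuous (avg η W) := by
  have hi : ∀ a b : ℝ, IntervalIntegrable W volume a b := fun a b =>
    (hW.integrableOn_isCompact isCompact_uIcc).intervalIntegrable
  have hc := intervalIntegral.continuous_primitive hi 0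
  have h : avg η W = fun x => η⁻¹ * ((∫ y in (0 : ℝ)..(x + η / 2), W y)
      - ∫ y in (0 : ℝ)..(x - η / 2), W y) := by
    funext x
    rw [avg, intervalIntegral.integral_interval_sub_left (hi _ _) (hi _ _)]
  rw [h]
  exact continuous_const.mul ((hc.comp (by fun_prop)).sub (hc.comp (by fun_prop)))

theorem memLp_avg (η : ℝ) {W : ℝ → ℝ} (hW : MemLp W 2) : MemLp (avg η W) 2 := by
  -- pass to a measurable representative
  wlog hm : StronglyMeasurable W generalizing W with H
  · have hae := hW.1.ae_eq_mk
    have h1 := H (hW.ae_eq hae) hW.1.stronglyMeasurable_mk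
    have h2 : avg η W = avg η (hW.1.mk W) := by
      funext x
      rw [avg, avg]
      congr 1
      exact intervalIntegral.integral_congr_ae (hae.mono fun x hx _ => hx)
    rwa [h2]
  have hloc : LocallyIntegrable W := hW.locallyIntegrable (by norm_num)
  refine ⟨(continuous_avg η hloc).aestronglyMeasurable, ?_⟩
  set J : Set ℝ := uIoc (-(η / 2)) (η / 2) with hJ
  have hJfin : volume J < ⊤ := by
    rw [hJ, uIoc]; exact measure_Ioc_lt_top
  -- pointwise bound by Cauchy-Schwarz
  have hpt : ∀ x, ‖avg η W x‖ₑ ^ (2 : ℝ) ≤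
      ‖η⁻¹‖ₑ ^ (2 : ℝ) * (volume J * ∫⁻ t in J, ‖W (x + t)‖ₑ ^ (2 : ℝ)) := by
    intro x
    have e1 : (∫ y in (x - η / 2)..(x + η / 2), W y)
        = ∫ t in (-(η / 2))..(η / 2), W (x + t) := by
      rw [intervalIntegral.integral_comp_add_left W x]
      rfl
    have e2 : ‖∫ t in (-(η / 2))..(η / 2), W (x + t)‖ₑ ≤ ∫⁻ t in J, ‖W (x + t)‖ₑ := by
      have : ‖∫ t in (-(η / 2))..(η / 2), W (x + t)‖ₑ = ‖∫ t in J, W (x + t)‖ₑ := by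
        rw [← ofReal_norm, ← ofReal_norm,
          intervalIntegral.norm_intervalIntegral_eq]
      rw [this]
      exact enorm_integral_le_lintegral_enorm _
    have e3 := ENNReal.lintegral_mul_le_Lp_mul_Lq (volume.restrict J)
      Real.HolderConjugate.two_two (f := fun t => ‖W (x + t)‖ₑ) (g := fun _ => 1)
      (hm.measurable.comp (measurable_const_add x)).enorm.aemeasurable aemeasurable_const
    simp only [Pi.mul_apply, mul_one, ENNReal.one_rpow, lintegral_const, one_mul,
      Measure.restrict_apply_univ] at e3
    rw [avg, e1, enorm_mul, ENNReal.mul_rpow_of_nonneg _ _ (by norm_num)]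
    gcongr
    calc _ ≤ ((∫⁻ t in J, ‖W (x + t)‖ₑ ^ (2 : ℝ)) ^ (1 / 2 : ℝ)
          * volume J ^ (1 / 2 : ℝ)) ^ (2 : ℝ) := by
          exact ENNReal.rpow_le_rpow (e2.trans e3) (by norm_num)
      _ = _ := by
          rw [ENNReal.mul_rpow_of_nonneg _ _ (by norm_num), ← ENNReal.rpow_mul,
            ← ENNReal.rpow_mul]
          norm_num [mul_comm]
  have hfin : ∫⁻ x, ‖W x‖ₑ ^ (2 : ℝ) < ⊤ := by
    have := lintegral_rpow_enorm_lt_top_of_eLpNorm_lt_top (by norm_num) (by norm_num) hW.2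
    simpa using this
  rw [eLpNorm_lt_top_iff_lintegral_rpow_enorm_lt_top (by norm_num) (by norm_num)]
  simp only [ENNReal.toReal_ofNat]
  refine (lintegral_mono hpt).trans_lt ?_
  have hmeas : Measurable (fun p : ℝ × ℝ => ‖W (p.1 + p.2)‖ₑ ^ (2 : ℝ)) :=
    (hm.measurable.comp (measurable_fst.add measurable_snd)).enorm.pow_const _
  rw [lintegral_const_mul' _ _ (ENNReal.rpow_ne_top_of_nonneg (by norm_num) enorm_ne_top),
    lintegral_const_mul' _ _ hJfin.ne,
    lintegral_lintegral_swap hmeas.aemeasurable]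
  have : ∀ t : ℝ, ∫⁻ x, ‖W (x + t)‖ₑ ^ (2 : ℝ) = ∫⁻ x, ‖W x‖ₑ ^ (2 : ℝ) := fun t =>
    lintegral_add_right_eq_self (fun x => ‖W x‖ₑ ^ (2 : ℝ)) t
  simp only [this, lintegral_const, Measure.restrict_apply_univ]
  exact ENNReal.mul_lt_top (ENNReal.rpow_lt_top_of_nonneg (by norm_num) enorm_ne_top)
    (ENNReal.mul_lt_top hJfin (ENNReal.mul_lt_top hfin hJfin))

/-- The averaging operator `𝒜_η : L²(ℝ) → L²(ℝ)`. -/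
def opA (η : ℝ) (V : L2) : L2 := (memLp_avg η (Lp.memLp V)).toLp (avg η V)

/-- `d₁ = 12 / ∫₀^∞ α(ξ) ξ⁴ dξ`. -/
def d1 (α : ℝ → ℝ) : ℝ := 12 / ∫ ξ in Ioi (0 : ℝ), α ξ * ξ ^ 4

/-- `d₂ = 12 ∫₀^∞ β(ξ) ξ³ dξ / ∫₀^∞ α(ξ) ξ⁴ dξ`. -/
def d2 (α β : ℝ → ℝ) : ℝ :=
  12 * (∫ ξ in Ioi (0 : ℝ), β ξ * ξ ^ 3) / ∫ ξ in Ioi (0 : ℝ), α ξ * ξ ^ 4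

/-- The KdV wave `W₀(x) = (3 d₁ / (2 d₂)) sech²(√d₁ x / 2)`. -/
def W0 (α β : ℝ → ℝ) (x : ℝ) : ℝ :=
  3 * d1 α / (2 * d2 α β) * (1 / Real.cosh (1 / 2 * √(d1 α) * x)) ^ 2

theorem continuous_W0 (α β : ℝ → ℝ) : Continuous (W0 α β) := by
  unfold W0
  refine continuous_const.mul ((continuous_const.div ?_ fun x => (Real.cosh_pos _).ne').pow 2)
  exact Real.continuous_cosh.comp (by fun_prop)

theorem norm_W0_le (α β : ℝ → ℝ) (x : ℝ) : ‖W0 α β x‖ ≤ |3 * d1 α / (2 * d2 α β)| := by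
  rw [W0, Real.norm_eq_abs, abs_mul]
  refine mul_le_of_le_one_right (abs_nonneg _) ?_
  have h1 := Real.one_le_cosh (1 / 2 * √(d1 α) * x)
  have h2 : 1 / Real.cosh (1 / 2 * √(d1 α) * x) ≤ 1 := by
    rw [div_le_one (by linarith)]; exact h1
  have h3 : 0 ≤ 1 / Real.cosh (1 / 2 * √(d1 α) * x) := by positivity
  rw [abs_of_nonneg (by positivity)]
  exact pow_le_one₀ h3 h2

theorem memLp_avg_W0_mul (α β : ℝ → ℝ) (η : ℝ) {V : ℝ → ℝ} (hV : MemLp V 2) :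
    MemLp (fun x => avg η (W0 α β) x * V x) 2 := by
  have hc := continuous_avg η (continuous_W0 α β).locallyIntegrable
  set M := |3 * d1 α / (2 * d2 α β)|
  refine hV.of_le_mul (c := |η⁻¹| * (M * |η|))
    (hc.aestronglyMeasurable.mul hV.1) (ae_of_all _ fun x => ?_)
  rw [norm_mul]
  gcongr
  rw [avg, norm_mul, Real.norm_eq_abs η⁻¹]
  gcongr
  refine (intervalIntegral.norm_integral_le_of_norm_le_const
    fun y _ => norm_W0_le α β y).trans_eq ?_
  congr 2
  ring

/-- Multiplication with `𝒜_η W₀`, as an operator on `L²(ℝ)`. -/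
def mulAvgW0 (α β : ℝ → ℝ) (η : ℝ) (V : L2) : L2 :=
  (memLp_avg_W0_mul α β η (Lp.memLp V)).toLp (fun x => avg η (W0 α β) x * (V : ℝ → ℝ) x)

/-- `ℬ_ε V = V + ∫₀^∞ α(ξ) ξ² (V - 𝒜_{εξ}² V) / ε² dξ`, a Bochner integral in `L²(ℝ)`. -/
def opB (α : ℝ → ℝ) (ε : ℝ) (V : L2) : L2 :=
  V + ∫ ξ in Ioi (0 : ℝ), (α ξ * ξ ^ 2 / ε ^ 2) • (V - opA (ε * ξ) (opA (ε * ξ) V))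

/-- `ℳ_ε V = 2 ∫₀^∞ β(ξ) ξ³ 𝒜_{εξ}((𝒜_{εξ} W₀)(𝒜_{εξ} V)) dξ`, a Bochner integral in `L²(ℝ)`. -/
def opM (α β : ℝ → ℝ) (ε : ℝ) (V : L2) : L2 :=
  (2 : ℝ) • ∫ ξ in Ioi (0 : ℝ),
    (β ξ * ξ ^ 3) • opA (ε * ξ) (mulAvgW0 α β (ε * ξ) (opA (ε * ξ) V))

/-- The linearized operator `ℒ_ε = ℬ_ε - ℳ_ε`. -/
def opL (α β : ℝ → ℝ) (ε : ℝ) (V : L2) : L2 := opB α ε V - opM α β ε V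

end Peridynamic

end

noncomputable section

namespace Peridynamic

open Polynomial
open scoped BoundedContinuousFunction

/-! The operator `opL α β ε` is symmetric, so a bounded sequence with `‖opL α β (ε n) (V n)‖ → 0`
can be tested against fixed functions. For `φ = sech²(c x) P(tanh(c x))` with `c = √d₁ / 2`, Taylor
expansion of the averages gives the strong limit `opL α β (ε n) φ → L₀ φ = φ - φ'' / d₁ - (2 d₂ /
d₁) W₀ φ`, hence `⟨V n, L₀ φ⟩ → 0`. On these functions `L₀` acts as a two-term recursion on powers
of `tanh` (`tanhL2_limit`, `limitPoly_X_pow`). It reaches every `sech⁴ tanh^m` except `m = 1`; that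
gap mirrors the kernel element `W₀'`, and evenness of `V n` fills it. As the functions `sech⁴
P(tanh)` are dense, `V n` tends weakly to zero (`tendsto_inner_zero`).

Weak convergence is upgraded by the identity `‖V‖² + energy = ⟨V, opL V⟩ + ⟨V, opM V⟩`, where the
energy integrates `‖V‖² - ‖avgOp (ε ξ) V‖²` and is nonnegative. This difference is the variance of
the translates of `V` over a window, so bounded energy yields `‖trans u V - V‖ ≤ M (|u| + ε)`
(`Admissible.exists_norm_trans_sub_le`). Thus `V n` is close to its averages at a fixed small scale.
Averages of a weakly null sequence tend to zero pointwise, and the decay of `W₀` turns this into `W₀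
V n → 0` in norm. Then `⟨V n, opM V n⟩ → 0` (`tendsto_inner_opM`), and the identity forces `‖V n‖ →
0`. -/

/-! ### Translations and averages on `L²(ℝ)`. -/

/-- Translation `(trans s V)(x) = V (x + s)` on `L²(ℝ)`. -/
def trans (s : ℝ) : L2 →ₗᵢ[ℝ] L2 :=
  Lp.compMeasurePreservingₗᵢ ℝ (fun x => x + s) (measurePreserving_add_right volume s)

theorem coeFn_trans (s : ℝ) (V : L2) : trans s V =ᵐ[volume] fun x => (V : ℝ → ℝ) (x + s) :=
  Lp.coeFn_compMeasurePreserving V (measurePreserving_add_right volume s)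

theorem trans_trans (s t : ℝ) (V : L2) : trans s (trans t V) = trans (s + t) V := by
  apply Lp.ext
  have h1 := coeFn_trans s (trans t V)
  have h2 := (measurePreserving_add_right volume s).quasiMeasurePreserving.ae (coeFn_trans t V)
  have h3 := coeFn_trans (s + t) V
  filter_upwards [h1, h2, h3] with x h1 h2 h3
  rw [h1, h2, h3, add_assoc]

theorem trans_zero (V : L2) : trans 0 V = V := by
  apply Lp.ext
  filter_upwards [coeFn_trans 0 V] with x h1
  rw [h1, add_zero]

theorem inner_trans_left (s : ℝ) (V W : L2) :
    inner ℝ (trans s V) W = inner ℝ V (trans (-s) W) := by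
  have h : W = trans s (trans (-s) W) := by rw [trans_trans, add_neg_cancel, trans_zero]
  conv_lhs => rw [h]
  exact (trans s).inner_map_map _ _

theorem continuous_trans {X : Type*} [TopologicalSpace X] {s : X → ℝ} {f : X → L2}
    (hs : Continuous s) (hf : Continuous f) : Continuous fun z => trans (s z) (f z) := by
  let g : C(X, C(ℝ, ℝ)) :=
    (ContinuousMap.mk (fun p : X × ℝ => p.2 + s p.1) (by fun_prop)).curry
  exact hf.compMeasurePreservingLp g.continuous
    (fun z => measurePreserving_add_right volume (s z)) (by norm_num)

theorem norm_trans_neg_sub (s : ℝ) (V : L2) : ‖trans (-s) V - V‖ = ‖trans s V - V‖ := by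
  rw [← (trans s).norm_map (trans (-s) V - V), map_sub, trans_trans, add_neg_cancel, trans_zero,
    norm_sub_rev]

/-- Telescoping over isometric translates; this carries estimates for short shifts over to long
ones. -/
theorem norm_trans_nat_mul_sub_le (m : ℕ) (u : ℝ) (V : L2) :
    ‖trans (m * u) V - V‖ ≤ m * ‖trans u V - V‖ := by
  induction m with
  | zero => simp [trans_zero]
  | succ m ih =>
    have h : trans ((m + 1 : ℕ) * u) V - V
        = trans u (trans (m * u) V - V) + (trans u V - V) := by
      rw [map_sub, trans_trans]
      push_cast
      rw [show u + m * u = (m + 1) * u by ring]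
      abel
    rw [h]
    refine (norm_add_le _ _).trans ?_
    rw [(trans u).norm_map]
    push_cast
    linarith

/-- The average of the translates `trans (η s) V` over `s ∈ [-1/2, 1/2]`. -/
def avgOp (η : ℝ) (V : L2) : L2 := ∫ s in (-(1 / 2) : ℝ)..(1 / 2), trans (η * s) V

theorem continuous_trans_mul (η : ℝ) (V : L2) : Continuous fun s : ℝ => trans (η * s) V :=
  continuous_trans (by fun_prop) continuous_const

theorem intervalIntegrable_trans (η : ℝ) (V : L2) (a b : ℝ) :
    IntervalIntegrable (fun s : ℝ => trans (η * s) V) volume a b :=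
  (continuous_trans_mul η V).intervalIntegrable _ _

theorem inner_avgOp_right (η : ℝ) (V φ : L2) :
    inner ℝ φ (avgOp η V) = ∫ s in (-(1 / 2) : ℝ)..(1 / 2), inner ℝ φ (trans (η * s) V) :=
  ((innerSL ℝ φ).intervalIntegral_comp_comm (intervalIntegrable_trans η V _ _)).symm

theorem inner_eq_integral_mul (V W : L2) :
    inner ℝ V W = ∫ x, (V : ℝ → ℝ) x * (W : ℝ → ℝ) x := by
  rw [L2.inner_def]
  congr 1
  funext x
  simp [mul_comm]

theorem avg_eq_integral_unit (W : ℝ → ℝ) {η : ℝ} (hη : η ≠ 0) (x : ℝ) :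
    avg η W x = ∫ s in (-(1 / 2) : ℝ)..(1 / 2), W (x + η * s) := by
  rw [intervalIntegral.integral_comp_add_mul W hη x, avg, smul_eq_mul]
  congr 2 <;> ring

theorem integrable_sq_coeFn (V : L2) : Integrable (fun x => (V : ℝ → ℝ) x ^ 2) :=
  (Lp.memLp V).integrable_sq

theorem integrable_mul_comp_shear (η : ℝ) (V φ : L2) :
    Integrable (Function.uncurry fun s x : ℝ => (φ : ℝ → ℝ) x * (V : ℝ → ℝ) (x + η * s))
      ((volume.restrict (Ioc (-(1 / 2) : ℝ) (1 / 2))).prod volume) := by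
  have hV : Measurable (V : ℝ → ℝ) := (Lp.stronglyMeasurable V).measurable
  have hφ : Measurable (φ : ℝ → ℝ) := (Lp.stronglyMeasurable φ).measurable
  have hm : Measurable (Function.uncurry fun s x : ℝ =>
      (φ : ℝ → ℝ) x * (V : ℝ → ℝ) (x + η * s)) := by
    unfold Function.uncurry
    fun_prop
  have hs : ∀ s : ℝ, Integrable fun x => ((φ : ℝ → ℝ) x ^ 2 + (V : ℝ → ℝ) (x + η * s) ^ 2) :=
    fun s => (integrable_sq_coeFn φ).add ((integrable_sq_coeFn V).comp_add_right (η * s))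
  have hb : ∀ s x : ℝ, ‖(φ : ℝ → ℝ) x * (V : ℝ → ℝ) (x + η * s)‖
      ≤ (φ : ℝ → ℝ) x ^ 2 + (V : ℝ → ℝ) (x + η * s) ^ 2 := by
    intro s x
    rw [Real.norm_eq_abs, abs_le]
    constructor <;> nlinarith [sq_nonneg ((φ : ℝ → ℝ) x + (V : ℝ → ℝ) (x + η * s)),
      sq_nonneg ((φ : ℝ → ℝ) x - (V : ℝ → ℝ) (x + η * s)), sq_nonneg ((φ : ℝ → ℝ) x),
      sq_nonneg ((V : ℝ → ℝ) (x + η * s))]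
  rw [integrable_prod_iff hm.aestronglyMeasurable]
  have hi : ∀ s : ℝ, Integrable fun x => (φ : ℝ → ℝ) x * (V : ℝ → ℝ) (x + η * s) := fun s =>
    (hs s).mono' (by fun_prop) (ae_of_all _ (hb s))
  refine ⟨ae_of_all _ hi, ?_⟩
  refine Integrable.mono' (integrable_const
    ((∫ x, (φ : ℝ → ℝ) x ^ 2) + ∫ x, (V : ℝ → ℝ) x ^ 2))
    hm.aestronglyMeasurable.norm.integral_prod_right' (ae_of_all _ fun s => ?_)
  rw [Real.norm_of_nonneg (integral_nonneg fun _ => norm_nonneg _)]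
  refine (integral_mono (hi s).norm (hs s) (hb s)).trans_eq ?_
  rw [integral_add (integrable_sq_coeFn φ) ((integrable_sq_coeFn V).comp_add_right (η * s)),
    integral_add_right_eq_self (fun x => (V : ℝ → ℝ) x ^ 2)]

/-- Fubini after pairing with an arbitrary `φ`. The case `η = 0` is excluded because `0⁻¹ = 0` makes
`opA 0` vanish, whereas `avgOp 0` is the identity; it is `avgOp` that is continuous in `η` through
`0`. -/
theorem opA_eq_avgOp {η : ℝ} (hη : η ≠ 0) (V : L2) : opA η V = avgOp η V := by
  refine ext_inner_left ℝ fun φ => ?_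
  rw [inner_avgOp_right, inner_eq_integral_mul]
  have h1 : (∫ x, (φ : ℝ → ℝ) x * (opA η V : ℝ → ℝ) x)
      = ∫ x, ∫ s in Ioc (-(1 / 2) : ℝ) (1 / 2), (φ : ℝ → ℝ) x * (V : ℝ → ℝ) (x + η * s) := by
    refine integral_congr_ae ?_
    filter_upwards [MemLp.coeFn_toLp (memLp_avg η (Lp.memLp V))] with x hx
    rw [opA, hx, avg_eq_integral_unit _ hη, integral_const_mul,
      intervalIntegral.integral_of_le (by norm_num)]
  rw [h1, ← integral_integral_swap (integrable_mul_comp_shear η V φ),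
    intervalIntegral.integral_of_le (by norm_num)]
  congr 1
  funext s
  rw [inner_eq_integral_mul]
  refine integral_congr_ae ?_
  filter_upwards [coeFn_trans (η * s) V] with x hx
  rw [hx]

theorem avgOp_zero_left (V : L2) : avgOp 0 V = V := by
  simp only [avgOp, zero_mul, trans_zero, intervalIntegral.integral_const]
  norm_num

theorem avgOp_sub (η : ℝ) (V W : L2) : avgOp η (V - W) = avgOp η V - avgOp η W := by
  simp only [avgOp, map_sub]
  exact intervalIntegral.integral_sub (intervalIntegrable_trans η V _ _)
    (intervalIntegrable_trans η W _ _)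

theorem avgOp_smul (η c : ℝ) (V : L2) : avgOp η (c • V) = c • avgOp η V := by
  simp only [avgOp, map_smul]
  exact intervalIntegral.integral_smul _ _

theorem norm_avgOp_le (η : ℝ) (V : L2) : ‖avgOp η V‖ ≤ ‖V‖ := by
  refine (intervalIntegral.norm_integral_le_of_norm_le_const (C := ‖V‖)
    fun s _ => ((trans (η * s)).norm_map V).le).trans_eq ?_
  norm_num

/-- The window is symmetric, so `s ↦ -s` exchanges each translation with its adjoint. -/
theorem inner_avgOp_left (η : ℝ) (V W : L2) :
    inner ℝ (avgOp η V) W = inner ℝ V (avgOp η W) := by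
  rw [real_inner_comm, inner_avgOp_right, inner_avgOp_right]
  have h := intervalIntegral.integral_comp_neg (a := (-(1 / 2) : ℝ)) (b := 1 / 2)
    (fun s : ℝ => inner ℝ V (trans (η * s) W))
  rw [neg_neg] at h
  rw [← h]
  refine intervalIntegral.integral_congr fun s _ => ?_
  rw [real_inner_comm, inner_trans_left, mul_neg]

theorem continuous_avgOp {X : Type*} [TopologicalSpace X] [FirstCountableTopology X]
    [LocallyCompactSpace X] {η : X → ℝ} {f : X → L2}
    (hη : Continuous η) (hf : Continuous f) : Continuous fun z => avgOp (η z) (f z) := by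
  unfold avgOp
  refine intervalIntegral.continuous_parametric_intervalIntegral_of_continuous' ?_ _ _
  exact continuous_trans (s := fun p : X × ℝ => η p.1 * p.2) (f := fun p => f p.1)
    (by fun_prop) (by fun_prop)

theorem norm_avgOp_sub_self_le {η C : ℝ} (V : L2)
    (h : ∀ u, |u| ≤ |η| / 2 → ‖trans u V - V‖ ≤ C) : ‖avgOp η V - V‖ ≤ C := by
  have e : avgOp η V - V = ∫ s in (-(1 / 2) : ℝ)..(1 / 2), (trans (η * s) V - V) := by
    rw [intervalIntegral.integral_sub (intervalIntegrable_trans η V _ _)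
      (intervalIntegrable_const), intervalIntegral.integral_const, avgOp]
    norm_num
  rw [e]
  refine (intervalIntegral.norm_integral_le_of_norm_le_const (C := C) fun s hs => ?_).trans_eq
    (by norm_num)
  apply h
  rw [uIoc_of_le (by norm_num)] at hs
  rw [abs_mul]
  have : |s| ≤ 1 / 2 := abs_le.2 ⟨hs.1.le, hs.2⟩
  nlinarith [abs_nonneg η]

/-- The variance of the translates of `V` over a window controls small translations. -/
theorem sq_norm_trans_sub_le {η u : ℝ} (hη : 0 < η) (hu : 0 ≤ u) (huη : u ≤ η / 2) (V : L2) :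
    ‖trans u V - V‖ ^ 2 ≤ 8 * (‖V‖ ^ 2 - ‖avgOp η V‖ ^ 2) := by
  set A := avgOp η V with hA
  set f : ℝ → ℝ := fun s => ‖trans (η * s) V - A‖ ^ 2 with hf
  have hfc : Continuous f := ((continuous_trans_mul η V).sub continuous_const).norm.pow 2
  have hfi : ∀ a b, IntervalIntegrable f volume a b := fun a b => hfc.intervalIntegrable a b
  -- Variance identity: translates all have norm `‖V‖`, and `A` is their mean.
  have hD : ∫ s in (-(1 / 2) : ℝ)..(1 / 2), f s = ‖V‖ ^ 2 - ‖A‖ ^ 2 := by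
    have e : ∀ s, f s = ‖V‖ ^ 2 + ‖A‖ ^ 2 - 2 * inner ℝ A (trans (η * s) V) := by
      intro s
      rw [hf]
      simp only
      rw [norm_sub_sq_real, (trans (η * s)).norm_map, real_inner_comm]
      ring
    have hci : Continuous fun s : ℝ => inner ℝ A (trans (η * s) V) :=
      continuous_const.inner (continuous_trans_mul η V)
    simp only [e]
    rw [intervalIntegral.integral_sub intervalIntegrable_const
      ((hci.intervalIntegrable _ _).const_mul 2), intervalIntegral.integral_const,
      intervalIntegral.integral_const_mul, ← inner_avgOp_right, ← hA, real_inner_self_eq_norm_sq]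
    norm_num
    ring
  set v := u / η with hv
  have hv0 : 0 ≤ v := by positivity
  have hv1 : v ≤ 1 / 2 := by rw [hv, div_le_iff₀ hη]; linarith
  have hpt : ∀ s, ‖trans u V - V‖ ^ 2 ≤ 2 * f s + 2 * f (s + v) := by
    intro s
    have e : ‖trans u V - V‖ = ‖(trans (η * (s + v)) V - A) - (trans (η * s) V - A)‖ := by
      have : η * (s + v) = η * s + u := by rw [hv]; field_simp
      rw [this, sub_sub_sub_cancel_right, ← trans_trans, ← map_sub, (trans (η * s)).norm_map]
    have h1 := norm_sub_le (trans (η * (s + v)) V - A) (trans (η * s) V - A)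
    rw [← e] at h1
    simp only [hf]
    nlinarith [norm_nonneg (trans u V - V), sq_nonneg
      (‖trans (η * (s + v)) V - A‖ - ‖trans (η * s) V - A‖)]
  have hsub : ∀ a b : ℝ, -(1 / 2) ≤ a → a ≤ b → b ≤ 1 / 2 →
      ∫ s in a..b, f s ≤ ‖V‖ ^ 2 - ‖A‖ ^ 2 := by
    intro a b ha hab hb
    rw [← hD]
    exact intervalIntegral.integral_mono_interval ha hab hb
      (ae_of_all _ fun s => sq_nonneg _) (hfi _ _)
  -- Averaging over `s ∈ [-1/2, 0]` only keeps `s + v` inside the window. This half-length interval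
  -- gives `‖trans u V - V‖² / 2 ≤ (2 + 2) (‖V‖² - ‖A‖²)`, whence the constant `8`.
  have h1 : ∫ _ in (-(1 / 2) : ℝ)..0, ‖trans u V - V‖ ^ 2
      ≤ ∫ s in (-(1 / 2) : ℝ)..0, (2 * f s + 2 * f (s + v)) :=
    intervalIntegral.integral_mono_on (by norm_num) intervalIntegrable_const
      (by apply Continuous.intervalIntegrable; fun_prop) fun s _ => hpt s
  rw [intervalIntegral.integral_add (by apply Continuous.intervalIntegrable; fun_prop)
    (by apply Continuous.intervalIntegrable; fun_prop), intervalIntegral.integral_const_mul,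
    intervalIntegral.integral_const_mul, intervalIntegral.integral_comp_add_right,
    intervalIntegral.integral_const] at h1
  have h2 := hsub (-(1 / 2)) 0 le_rfl (by norm_num) (by norm_num)
  have h3 := hsub (-(1 / 2) + v) (0 + v) (by linarith) (by linarith) (by linarith)
  norm_num at h1 h2 h3
  linarith

/-! ### Polynomials in `tanh` and the decay of `sech²`. -/

theorem hasDerivAt_tanh (x : ℝ) : HasDerivAt Real.tanh (1 - Real.tanh x ^ 2) x := by
  have h := (Real.hasDerivAt_sinh x).div (Real.hasDerivAt_cosh x) (Real.cosh_pos x).ne'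
  have e : Real.tanh = Real.sinh / Real.cosh := by
    funext y; exact Real.tanh_eq_sinh_div_cosh y
  rw [e]
  refine h.congr_deriv ?_
  have := (Real.cosh_pos x).ne'
  simp only [Pi.div_apply]
  field_simp

theorem one_sub_sq_tanh (x : ℝ) : 1 - Real.tanh x ^ 2 = (1 / Real.cosh x) ^ 2 := by
  have := (Real.cosh_pos x).ne'
  have h := Real.cosh_sq x
  rw [Real.tanh_eq_sinh_div_cosh]
  field_simp
  linarith

/-- From `|x| ≤ |sinh x|`; this rational majorant suffices to put `sech²` into `L²`. -/
theorem one_sub_sq_tanh_le (x : ℝ) : 1 - Real.tanh x ^ 2 ≤ (1 + x ^ 2)⁻¹ := by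
  rw [one_sub_sq_tanh, one_div, inv_pow]
  have h : x ^ 2 ≤ Real.sinh x ^ 2 := by
    rw [sq_le_sq, Real.abs_sinh]
    exact Real.self_le_sinh_iff.2 (abs_nonneg x)
  rw [Real.cosh_sq, add_comm (Real.sinh x ^ 2)]
  gcongr

theorem one_sub_sq_tanh_nonneg (x : ℝ) : 0 ≤ 1 - Real.tanh x ^ 2 := by
  rw [one_sub_sq_tanh]; positivity

/-- `sech²` varies by at most an exponential factor under translations. -/
theorem one_sub_sq_tanh_add_le (x t : ℝ) :
    1 - Real.tanh (x + t) ^ 2 ≤ Real.exp (2 * |t|) * (1 - Real.tanh x ^ 2) := by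
  have h : Real.cosh x ≤ Real.exp |t| * Real.cosh (x + t) := by
    have e : x = x + t - t := by ring
    have h1 : Real.cosh x = Real.cosh (x + t) * Real.cosh t - Real.sinh (x + t) * Real.sinh t := by
      conv_lhs => rw [e, Real.cosh_sub]
    have h2 : |Real.sinh (x + t)| ≤ Real.cosh (x + t) := by
      have := Real.cosh_sq (x + t)
      exact abs_le_of_sq_le_sq (by linarith) (Real.cosh_pos _).le
    have h3 : -(Real.sinh (x + t) * Real.sinh t) ≤ Real.cosh (x + t) * |Real.sinh t| := by
      refine (neg_le_abs _).trans ?_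
      rw [abs_mul]
      gcongr
    have h4 : Real.exp |t| = Real.cosh t + |Real.sinh t| := by
      rw [← Real.cosh_abs, Real.abs_sinh, Real.cosh_add_sinh]
    rw [h1, h4]
    nlinarith
  rw [one_sub_sq_tanh, one_sub_sq_tanh]
  have hx := Real.cosh_pos x
  have hxt := Real.cosh_pos (x + t)
  have e : Real.exp (2 * |t|) = Real.exp |t| ^ 2 := by rw [← Real.exp_nat_mul]; norm_num
  rw [e, ← mul_pow]
  gcongr
  rw [mul_one_div, div_le_div_iff₀ hxt hx]
  linarith

/-- The function `x ↦ Q(tanh (c x))`. -/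
def tanhPoly (c : ℝ) (Q : ℝ[X]) (x : ℝ) : ℝ := Q.eval (Real.tanh (c * x))

theorem hasDerivAt_tanhPoly (c : ℝ) (Q : ℝ[X]) (x : ℝ) :
    HasDerivAt (tanhPoly c Q) (tanhPoly c ((1 - X ^ 2) * (C c * derivative Q)) x) x := by
  have h1 : HasDerivAt (fun x : ℝ => c * x) c x := by
    simpa using (hasDerivAt_id x).const_mul c
  have h := (Q.hasDerivAt (Real.tanh (c * x))).comp x ((hasDerivAt_tanh (c * x)).comp x h1)
  refine h.congr_deriv ?_
  simp only [tanhPoly, eval_mul, eval_sub, eval_one, eval_pow, eval_X, eval_C]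
  ring

theorem continuous_tanhPoly (c : ℝ) (Q : ℝ[X]) : Continuous (tanhPoly c Q) :=
  continuous_iff_continuousAt.2 fun x => (hasDerivAt_tanhPoly c Q x).continuousAt

theorem exists_norm_eval_le (Q : ℝ[X]) :
    ∃ M : ℝ, 0 ≤ M ∧ ∀ x : ℝ, |Q.eval (Real.tanh x)| ≤ M := by
  obtain ⟨M, hM⟩ := (isCompact_Icc (a := (-1 : ℝ)) (b := 1)).exists_bound_of_continuousOn
    Q.continuous.continuousOn
  have h : ∀ x : ℝ, |Q.eval (Real.tanh x)| ≤ M := fun x =>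
    hM _ ⟨(Real.neg_one_lt_tanh x).le, (Real.tanh_lt_one x).le⟩
  exact ⟨M, (abs_nonneg _).trans (h 0), h⟩

theorem memLp_sech_sq {c : ℝ} (hc : 0 < c) :
    MemLp (fun x : ℝ => 1 - Real.tanh (c * x) ^ 2) 2 := by
  have hcont : Continuous fun x : ℝ => 1 - Real.tanh (c * x) ^ 2 := by
    have := continuous_tanhPoly c (1 - X ^ 2)
    unfold tanhPoly at this
    simpa using this
  rw [memLp_two_iff_integrable_sq hcont.aestronglyMeasurable]
  refine (integrable_inv_one_add_sq.comp_mul_left' hc.ne').mono'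
    (hcont.pow 2).aestronglyMeasurable (ae_of_all _ fun x => ?_)
  rw [Real.norm_of_nonneg (sq_nonneg _)]
  have h0 := one_sub_sq_tanh_nonneg (c * x)
  have h1 := one_sub_sq_tanh_le (c * x)
  nlinarith [sq_nonneg (Real.tanh (c * x))]

theorem memLp_tanhPoly {c : ℝ} (hc : 0 < c) (P : ℝ[X]) :
    MemLp (tanhPoly c ((1 - X ^ 2) * P)) 2 := by
  obtain ⟨M, -, hM⟩ := exists_norm_eval_le P
  refine (memLp_sech_sq hc).of_le_mul (c := M) (continuous_tanhPoly _ _).aestronglyMeasurable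
    (ae_of_all _ fun x => ?_)
  have h0 := one_sub_sq_tanh_nonneg (c * x)
  simp only [tanhPoly, eval_mul, eval_sub, eval_one, eval_pow, eval_X, norm_mul, Real.norm_eq_abs]
  rw [mul_comm]
  gcongr
  exact hM _

theorem exists_lipschitz_tanhPoly (c : ℝ) (Q : ℝ[X]) :
    ∃ L : ℝ, 0 ≤ L ∧ ∀ x y, |tanhPoly c Q x - tanhPoly c Q y| ≤ L * |x - y| := by
  obtain ⟨M, hM0, hM⟩ := exists_norm_eval_le ((1 - X ^ 2) * (C c * derivative Q))
  refine ⟨M, hM0, fun x y => ?_⟩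
  exact convex_univ.norm_image_sub_le_of_norm_hasDerivWithin_le
    (fun z _ => (hasDerivAt_tanhPoly c Q z).hasDerivWithinAt)
    (fun z _ => hM _) (mem_univ y) (mem_univ x)

/-! ### Multiplication operators and the averaged wave. -/

theorem memLp_mul (w : ℝ →ᵇ ℝ) {V : ℝ → ℝ} (hV : MemLp V 2) :
    MemLp (fun x => w x * V x) 2 :=
  hV.of_le_mul (c := ‖w‖) (w.continuous.aestronglyMeasurable.mul hV.1) (ae_of_all _ fun x => by
    rw [norm_mul]; gcongr; exact w.norm_coe_le_norm x)

/-- Multiplication with a bounded continuous function on `L²(ℝ)`, as a bilinear map. -/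
def mulOp : (ℝ →ᵇ ℝ) →L[ℝ] L2 →L[ℝ] L2 :=
  LinearMap.mkContinuous₂
    (LinearMap.mk₂ ℝ
      (fun w V => (memLp_mul w (Lp.memLp V)).toLp _)
      (fun w w' V => by
        rw [← MemLp.toLp_add]
        congr 1
        funext x
        simp [add_mul])
      (fun r w V => by
        rw [← MemLp.toLp_const_smul]
        congr 1
        funext x
        simp [mul_assoc])
      (fun w V V' => by
        rw [← MemLp.toLp_add, MemLp.toLp_eq_toLp_iff]
        filter_upwards [Lp.coeFn_add V V'] with x hx
        simp only [hx, Pi.add_apply, mul_add])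
      (fun r w V => by
        rw [← MemLp.toLp_const_smul, MemLp.toLp_eq_toLp_iff]
        filter_upwards [Lp.coeFn_smul r V] with x hx
        simp only [hx, Pi.smul_apply, smul_eq_mul]
        ring))
    1 (fun w V => by
      rw [one_mul]
      refine Lp.norm_le_mul_norm_of_ae_le_mul ?_
      rw [LinearMap.mk₂_apply]
      refine (MemLp.coeFn_toLp (memLp_mul w (Lp.memLp V))).mono fun x hx => ?_
      rw [hx, norm_mul]
      gcongr
      exact w.norm_coe_le_norm x)

theorem coeFn_mulOp (w : ℝ →ᵇ ℝ) (V : L2) :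
    mulOp w V =ᵐ[volume] fun x => w x * (V : ℝ → ℝ) x :=
  MemLp.coeFn_toLp (memLp_mul w (Lp.memLp V))

theorem norm_mulOp_le (w : ℝ →ᵇ ℝ) (V : L2) : ‖mulOp w V‖ ≤ ‖w‖ * ‖V‖ := by
  refine Lp.norm_le_mul_norm_of_ae_le_mul ((coeFn_mulOp w V).mono fun x hx => ?_)
  rw [hx, norm_mul]
  gcongr
  exact w.norm_coe_le_norm x

theorem inner_mulOp_left (w : ℝ →ᵇ ℝ) (V W : L2) :
    inner ℝ (mulOp w V) W = inner ℝ V (mulOp w W) := by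
  rw [inner_eq_integral_mul, inner_eq_integral_mul]
  refine integral_congr_ae ?_
  filter_upwards [coeFn_mulOp w V, coeFn_mulOp w W] with x h1 h2
  rw [h1, h2]
  ring

theorem W0_eq_tanhPoly (α β : ℝ → ℝ) :
    W0 α β = tanhPoly (1 / 2 * √(d1 α)) (C (3 * d1 α / (2 * d2 α β)) * (1 - X ^ 2)) := by
  funext x
  simp only [W0, tanhPoly, eval_mul, eval_sub, eval_one, eval_pow, eval_X, eval_C,
    one_sub_sq_tanh]

/-- The function `x ↦ ∫_{-1/2}^{1/2} W₀(x + η s) ds`, which is `𝒜_η W₀` for `η ≠ 0` and `W₀`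
for `η = 0`. -/
def avgW0 (α β : ℝ → ℝ) (η : ℝ) : ℝ →ᵇ ℝ :=
  BoundedContinuousFunction.ofNormedAddCommGroup
    (fun x => ∫ s in (-(1 / 2) : ℝ)..(1 / 2), W0 α β (x + η * s))
    (by
      refine intervalIntegral.continuous_parametric_intervalIntegral_of_continuous' ?_ _ _
      exact (continuous_W0 α β).comp (by fun_prop))
    |3 * d1 α / (2 * d2 α β)|
    (fun x => by
      refine (intervalIntegral.norm_integral_le_of_norm_le_const
        fun s _ => norm_W0_le α β (x + η * s)).trans_eq ?_
      norm_num)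

theorem avgW0_apply (α β : ℝ → ℝ) (η x : ℝ) :
    avgW0 α β η x = ∫ s in (-(1 / 2) : ℝ)..(1 / 2), W0 α β (x + η * s) := rfl

theorem avgW0_zero_apply (α β : ℝ → ℝ) (x : ℝ) : avgW0 α β 0 x = W0 α β x := by
  simp only [avgW0_apply, zero_mul, add_zero, intervalIntegral.integral_const]
  norm_num

theorem norm_avgW0_le (α β : ℝ → ℝ) (η : ℝ) : ‖avgW0 α β η‖ ≤ |3 * d1 α / (2 * d2 α β)| :=
  BoundedContinuousFunction.norm_ofNormedAddCommGroup_le _ (abs_nonneg _) _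

/-- `W₀` is Lipschitz, so its averages are Lipschitz in `η` for the sup norm, also at `η = 0`. -/
theorem continuous_avgW0 (α β : ℝ → ℝ) : Continuous (avgW0 α β) := by
  obtain ⟨L, hL0, hL⟩ := exists_lipschitz_tanhPoly (1 / 2 * √(d1 α))
    (C (3 * d1 α / (2 * d2 α β)) * (1 - X ^ 2))
  rw [← W0_eq_tanhPoly] at hL
  refine (LipschitzWith.of_dist_le_mul (K := L.toNNReal) fun η η' => ?_).continuous
  rw [Real.coe_toNNReal _ hL0]
  refine (BoundedContinuousFunction.dist_le (by positivity)).2 fun x => ?_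
  have hi : ∀ η : ℝ, IntervalIntegrable (fun s => W0 α β (x + η * s)) volume (-(1 / 2)) (1 / 2) :=
    fun η => ((continuous_W0 α β).comp (by fun_prop)).intervalIntegrable _ _
  rw [avgW0_apply, avgW0_apply, dist_eq_norm, ← intervalIntegral.integral_sub (hi _) (hi _)]
  refine (intervalIntegral.norm_integral_le_of_norm_le_const (C := L * dist η η')
    fun s hs => ?_).trans_eq (by norm_num)
  refine (hL _ _).trans ?_
  rw [uIoc_of_le (by norm_num)] at hs
  have hs1 : |s| ≤ 1 := abs_le.2 ⟨by linarith [hs.1], by linarith [hs.2]⟩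
  rw [show x + η * s - (x + η' * s) = (η - η') * s by ring, abs_mul, Real.dist_eq]
  gcongr
  exact mul_le_of_le_one_right (abs_nonneg _) hs1

theorem mulAvgW0_eq_mulOp (α β : ℝ → ℝ) {η : ℝ} (hη : η ≠ 0) (V : L2) :
    mulAvgW0 α β η V = mulOp (avgW0 α β η) V := by
  apply Lp.ext
  filter_upwards [coeFn_mulOp (avgW0 α β η) V,
    MemLp.coeFn_toLp (memLp_avg_W0_mul α β η (Lp.memLp V))] with x h1 h2
  rw [h1, mulAvgW0, h2, avg_eq_integral_unit _ hη, avgW0_apply]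

/-! ### The integrals over `ξ` defining `opB` and `opM`. -/

theorem PosFiniteMoment.integrableOn_natPow {f : ℝ → ℝ} {p : ℝ} (h : PosFiniteMoment f p) (n : ℕ)
    (hn : (n : ℝ) = p) : IntegrableOn (fun ξ => f ξ * ξ ^ n) (Ioi 0) := by
  have := h.1
  simpa only [← hn, Real.rpow_natCast] using this

theorem PosFiniteMoment.integral_natPow_pos {f : ℝ → ℝ} {p : ℝ} (h : PosFiniteMoment f p) (n : ℕ)
    (hn : (n : ℝ) = p) : 0 < ∫ ξ in Ioi (0 : ℝ), f ξ * ξ ^ n := by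
  have := h.2
  simpa only [← hn, Real.rpow_natCast] using this

theorem integrableOn_smul_of_bounded {g : ℝ → ℝ} {F : ℝ → L2} {C : ℝ}
    (hg : IntegrableOn g (Ioi 0)) (hF : ContinuousOn F (Ioi 0))
    (hC : ∀ ξ, 0 < ξ → ‖F ξ‖ ≤ C) : IntegrableOn (fun ξ => g ξ • F ξ) (Ioi 0) := by
  refine Integrable.mono' (hg.norm.mul_const C)
    (hg.aestronglyMeasurable.smul (hF.aestronglyMeasurable measurableSet_Ioi)) ?_
  filter_upwards [ae_restrict_mem measurableSet_Ioi] with ξ hξ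
  rw [norm_smul]
  gcongr
  exact hC ξ hξ

/-- Dominated convergence: `ε n * ξ → 0` from the right for each fixed `ξ > 0`. A one-sided limit is
what is available for `s ↦ (s ^ 2)⁻¹ • avgDefect s φ`. -/
theorem tendsto_setIntegral_smul_comp_mul {g : ℝ → ℝ} {F : ℝ → L2} {F₀ : L2} {C : ℝ}
    (hg : IntegrableOn g (Ioi 0)) (hF : ContinuousOn F (Ioi 0)) (hC : ∀ ξ, 0 < ξ → ‖F ξ‖ ≤ C)
    (h0 : Tendsto F (𝓝[>] 0) (𝓝 F₀)) {ε : ℕ → ℝ} (hpos : ∀ n, 0 < ε n)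
    (hε : Tendsto ε atTop (𝓝 0)) :
    Tendsto (fun n => ∫ ξ in Ioi (0 : ℝ), g ξ • F (ε n * ξ)) atTop
      (𝓝 ((∫ ξ in Ioi (0 : ℝ), g ξ) • F₀)) := by
  rw [← integral_smul_const]
  refine tendsto_integral_of_dominated_convergence (fun ξ => ‖g ξ‖ * C) (fun n => ?_)
    (hg.norm.mul_const C) (fun n => ?_) ?_
  · refine hg.aestronglyMeasurable.smul ((hF.comp (by fun_prop) fun ξ hξ => ?_).aestronglyMeasurable
      measurableSet_Ioi)
    exact mul_pos (hpos n) hξ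
  · filter_upwards [ae_restrict_mem measurableSet_Ioi] with ξ hξ
    rw [norm_smul]
    gcongr
    exact hC _ (mul_pos (hpos n) hξ)
  · filter_upwards [ae_restrict_mem measurableSet_Ioi] with ξ hξ
    refine tendsto_const_nhds.smul (h0.comp ?_)
    refine tendsto_nhdsWithin_iff.2 ⟨?_, Eventually.of_forall fun n => mul_pos (hpos n) hξ⟩
    simpa using hε.mul_const ξ

/-- `V - 𝒜_η² V`. -/
def avgDefect (η : ℝ) (V : L2) : L2 := V - avgOp η (avgOp η V)

/-- `𝒜_η ((𝒜_η W₀) (𝒜_η V))`. -/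
def avgMul (α β : ℝ → ℝ) (η : ℝ) (V : L2) : L2 := avgOp η (mulOp (avgW0 α β η) (avgOp η V))

theorem continuous_avgDefect (V : L2) : Continuous fun η => avgDefect η V :=
  continuous_const.sub (continuous_avgOp continuous_id (continuous_avgOp continuous_id
    continuous_const))

theorem continuous_avgMul (α β : ℝ → ℝ) (V : L2) : Continuous fun η => avgMul α β η V :=
  continuous_avgOp continuous_id (((mulOp.continuous.comp (continuous_avgW0 α β))).clm_apply
    (continuous_avgOp continuous_id continuous_const))

theorem norm_avgDefect_le (η : ℝ) (V : L2) : ‖avgDefect η V‖ ≤ 2 * ‖V‖ := by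
  refine (norm_sub_le _ _).trans ?_
  linarith [norm_avgOp_le η (avgOp η V), norm_avgOp_le η V]

theorem norm_avgMul_le (α β : ℝ → ℝ) (η : ℝ) (V : L2) :
    ‖avgMul α β η V‖ ≤ |3 * d1 α / (2 * d2 α β)| * ‖V‖ := by
  refine (norm_avgOp_le _ _).trans ((norm_mulOp_le _ _).trans ?_)
  gcongr
  · exact norm_avgW0_le α β η
  · exact norm_avgOp_le η V

theorem inner_avgDefect_left (η : ℝ) (V W : L2) :
    inner ℝ (avgDefect η V) W = inner ℝ V (avgDefect η W) := by
  rw [avgDefect, avgDefect, inner_sub_left, inner_sub_right, inner_avgOp_left, inner_avgOp_left]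

theorem inner_avgMul_left (α β : ℝ → ℝ) (η : ℝ) (V W : L2) :
    inner ℝ (avgMul α β η V) W = inner ℝ V (avgMul α β η W) := by
  rw [avgMul, avgMul, inner_avgOp_left, inner_mulOp_left, inner_avgOp_left]

/-- Exhibits the quadratic form of `opB` as an integral of variances of translates. -/
theorem inner_avgDefect_self (η : ℝ) (V : L2) :
    inner ℝ V (avgDefect η V) = ‖V‖ ^ 2 - ‖avgOp η V‖ ^ 2 := by
  rw [avgDefect, inner_sub_right, ← inner_avgOp_left, real_inner_self_eq_norm_sq,
    real_inner_self_eq_norm_sq]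

theorem opB_eq (α : ℝ → ℝ) {ε : ℝ} (hε : 0 < ε) (V : L2) :
    opB α ε V = V + ∫ ξ in Ioi (0 : ℝ), (α ξ * ξ ^ 2 / ε ^ 2) • avgDefect (ε * ξ) V := by
  rw [opB]
  congr 1
  refine setIntegral_congr_fun measurableSet_Ioi fun ξ hξ => ?_
  have h : ε * ξ ≠ 0 := (mul_pos hε hξ).ne'
  simp only [opA_eq_avgOp h, avgDefect]

theorem opM_eq (α β : ℝ → ℝ) {ε : ℝ} (hε : 0 < ε) (V : L2) :
    opM α β ε V = (2 : ℝ) • ∫ ξ in Ioi (0 : ℝ), (β ξ * ξ ^ 3) • avgMul α β (ε * ξ) V := by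
  rw [opM]
  congr 1
  refine setIntegral_congr_fun measurableSet_Ioi fun ξ hξ => ?_
  have h : ε * ξ ≠ 0 := (mul_pos hε hξ).ne'
  simp only [opA_eq_avgOp h, mulAvgW0_eq_mulOp α β h, avgMul]

theorem Admissible.integrableOn_alpha_two {α β : ℝ → ℝ} (h : Admissible α β)
    : IntegrableOn (fun ξ => α ξ * ξ ^ 2) (Ioi 0) :=
  h.alpha_two.integrableOn_natPow 2 (by norm_num)

theorem Admissible.integrableOn_beta_three {α β : ℝ → ℝ} (h : Admissible α β)
    : IntegrableOn (fun ξ => β ξ * ξ ^ 3) (Ioi 0) :=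
  h.beta_three.integrableOn_natPow 3 (by norm_num)

theorem Admissible.integrableOn_avgDefect {α β : ℝ → ℝ} (h : Admissible α β)
    (ε : ℝ) (V : L2) :
    IntegrableOn (fun ξ => (α ξ * ξ ^ 2 / ε ^ 2) • avgDefect (ε * ξ) V) (Ioi 0) :=
  integrableOn_smul_of_bounded (h.integrableOn_alpha_two.div_const _)
    ((continuous_avgDefect V).comp (continuous_const.mul continuous_id)).continuousOn
    fun _ _ => norm_avgDefect_le _ V

theorem Admissible.integrableOn_avgMul {α β : ℝ → ℝ} (h : Admissible α β)
    (ε : ℝ) (V : L2) :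
    IntegrableOn (fun ξ => (β ξ * ξ ^ 3) • avgMul α β (ε * ξ) V) (Ioi 0) :=
  integrableOn_smul_of_bounded h.integrableOn_beta_three
    ((continuous_avgMul α β V).comp (continuous_const.mul continuous_id)).continuousOn
    fun _ _ => norm_avgMul_le _ _ _ V

theorem Admissible.inner_opB {α β : ℝ → ℝ} (h : Admissible α β)
    {ε : ℝ} (hε : 0 < ε) (V φ : L2) :
    inner ℝ φ (opB α ε V) = inner ℝ φ V
      + ∫ ξ in Ioi (0 : ℝ), (α ξ * ξ ^ 2 / ε ^ 2) * inner ℝ φ (avgDefect (ε * ξ) V) := by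
  rw [opB_eq α hε, inner_add_right, ← integral_inner (h.integrableOn_avgDefect ε V)]
  simp only [real_inner_smul_right]

theorem Admissible.inner_opM {α β : ℝ → ℝ} (h : Admissible α β)
    {ε : ℝ} (hε : 0 < ε) (V φ : L2) :
    inner ℝ φ (opM α β ε V)
      = 2 * ∫ ξ in Ioi (0 : ℝ), (β ξ * ξ ^ 3) * inner ℝ φ (avgMul α β (ε * ξ) V) := by
  rw [opM_eq α β hε, real_inner_smul_right, ← integral_inner (h.integrableOn_avgMul ε V)]
  simp only [real_inner_smul_right]

theorem Admissible.inner_opL_left {α β : ℝ → ℝ} (h : Admissible α β)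
    {ε : ℝ} (hε : 0 < ε) (V W : L2) :
    inner ℝ (opL α β ε V) W = inner ℝ V (opL α β ε W) := by
  rw [real_inner_comm, opL, opL, inner_sub_right, inner_sub_right, h.inner_opB hε, h.inner_opB hε,
    h.inner_opM hε, h.inner_opM hε]
  have hd : ∀ η, inner ℝ W (avgDefect η V) = inner ℝ V (avgDefect η W) := fun η => by
    rw [real_inner_comm, inner_avgDefect_left]
  have hm : ∀ η, inner ℝ W (avgMul α β η V) = inner ℝ V (avgMul α β η W) := fun η => by
    rw [real_inner_comm, inner_avgMul_left]
  simp only [hd, hm]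
  rw [real_inner_comm V W]

theorem Admissible.abs_inner_opM_le {α β : ℝ → ℝ} (h : Admissible α β)
    {ε : ℝ} (hε : 0 < ε) (V : L2) :
    |inner ℝ V (opM α β ε V)|
      ≤ 2 * (|3 * d1 α / (2 * d2 α β)| * ∫ ξ in Ioi (0 : ℝ), β ξ * ξ ^ 3) * ‖V‖ ^ 2 := by
  rw [h.inner_opM hε, abs_mul, abs_two, mul_assoc 2]
  gcongr
  rw [mul_assoc, mul_left_comm, ← integral_mul_const, ← Real.norm_eq_abs]
  refine norm_integral_le_of_norm_le (h.integrableOn_beta_three.mul_const _) ?_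
  filter_upwards [ae_restrict_mem measurableSet_Ioi] with ξ hξ
  have h0 : 0 ≤ β ξ * ξ ^ 3 := mul_nonneg (h.beta_nonneg ξ hξ) (pow_nonneg (le_of_lt hξ) 3)
  rw [norm_mul, Real.norm_of_nonneg h0]
  gcongr
  refine (norm_inner_le_norm _ _).trans ?_
  have := norm_avgMul_le α β (ε * ξ) V
  nlinarith [norm_nonneg V]

/-- If `(φ - 𝒜_s² φ) / s² → -φ₂ / 12` as `s → 0`, then `ℬ_ε φ → φ - φ₂ / d₁` as `ε → 0`. -/
theorem Admissible.tendsto_opB {α β : ℝ → ℝ} (h : Admissible α β) {φ φ₂ : L2} {C : ℝ}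
    (hC : ∀ s : ℝ, 0 < s → ‖(s ^ 2)⁻¹ • avgDefect s φ‖ ≤ C)
    (hφ : Tendsto (fun s : ℝ => (s ^ 2)⁻¹ • avgDefect s φ) (𝓝[>] 0) (𝓝 (-(1 / 12 : ℝ) • φ₂)))
    {ε : ℕ → ℝ} (hpos : ∀ n, 0 < ε n) (hε : Tendsto ε atTop (𝓝 0)) :
    Tendsto (fun n => opB α (ε n) φ) atTop (𝓝 (φ - (d1 α)⁻¹ • φ₂)) := by
  have hc : ContinuousOn (fun s : ℝ => (s ^ 2)⁻¹ • avgDefect s φ) (Ioi 0) := by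
    have hi : ContinuousOn (fun s : ℝ => (s ^ 2)⁻¹) (Ioi 0) :=
      (continuous_pow 2).continuousOn.inv₀ fun x hx => pow_ne_zero 2 (ne_of_gt hx)
    exact hi.smul (continuous_avgDefect φ).continuousOn
  -- The splitting `α ξ² / ε² = (α ξ⁴) (ε ξ)⁻²` brings in the fourth moment, that is `12 / d₁`.
  have h1 := tendsto_setIntegral_smul_comp_mul
    (h.alpha_four.integrableOn_natPow 4 (by norm_num)) hc hC hφ hpos hε
  have h2 := h1.const_add φ
  have e1 : φ + (∫ ξ in Ioi (0 : ℝ), α ξ * ξ ^ 4) • -(1 / 12 : ℝ) • φ₂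
      = φ - (d1 α)⁻¹ • φ₂ := by
    rw [sub_eq_add_neg, ← neg_smul, smul_smul, d1, inv_div]
    congr 2
    ring
  rw [e1] at h2
  refine h2.congr fun n => ?_
  rw [opB_eq α (hpos n)]
  congr 1
  refine setIntegral_congr_fun measurableSet_Ioi fun ξ hξ => ?_
  have h3 : ξ ≠ 0 := ne_of_gt hξ
  have h4 := (hpos n).ne'
  simp only [smul_smul]
  congr 1
  field_simp

theorem Admissible.tendsto_opM {α β : ℝ → ℝ} (h : Admissible α β) (φ : L2)
    {ε : ℕ → ℝ} (hpos : ∀ n, 0 < ε n) (hε : Tendsto ε atTop (𝓝 0)) :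
    Tendsto (fun n => opM α β (ε n) φ) atTop
      (𝓝 ((2 * (d2 α β / d1 α)) • mulOp (avgW0 α β 0) φ)) := by
  have ha := h.alpha_four.integral_natPow_pos 4 (by norm_num)
  have h0 : Tendsto (fun s => avgMul α β s φ) (𝓝[>] 0) (𝓝 (avgMul α β 0 φ)) :=
    ((continuous_avgMul α β φ).tendsto 0).mono_left nhdsWithin_le_nhds
  have h1 := tendsto_setIntegral_smul_comp_mul h.integrableOn_beta_three
    (continuous_avgMul α β φ).continuousOn (fun ξ _ => norm_avgMul_le α β ξ φ) h0 hpos hε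
  have h2 := h1.const_smul (2 : ℝ)
  have e1 : d2 α β / d1 α = ∫ ξ in Ioi (0 : ℝ), β ξ * ξ ^ 3 := by
    rw [d1, d2]
    field_simp
  rw [smul_smul, avgMul, avgOp_zero_left, avgOp_zero_left, ← e1] at h2
  exact h2.congr fun n => (opM_eq α β (hpos n) φ).symm

/-! ### Taylor expansion of averages on the test functions. -/

/-- Three applications of the mean value inequality, at the price of the constant `1` instead of
`1/6`. The bound on `f₃` is only local, so that `M` may depend on `x`. -/
theorem abs_sub_taylor_two_le {f f₁ f₂ f₃ : ℝ → ℝ} (h₀ : ∀ x, HasDerivAt f (f₁ x) x)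
    (h₁ : ∀ x, HasDerivAt f₁ (f₂ x) x) (h₂ : ∀ x, HasDerivAt f₂ (f₃ x) x) {x r M : ℝ}
    (hM : ∀ t, |t| ≤ |r| → |f₃ (x + t)| ≤ M) :
    |f (x + r) - f x - r * f₁ x - r ^ 2 / 2 * f₂ x| ≤ M * |r| ^ 3 := by
  have hM0 : 0 ≤ M := (abs_nonneg _).trans (hM 0 (by simp))
  set S := Icc (-|r|) |r| with hS
  have hSc : Convex ℝ S := convex_Icc _ _
  have hS0 : (0 : ℝ) ∈ S := ⟨by simp, abs_nonneg r⟩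
  have hSr : ∀ t ∈ S, |t| ≤ |r| := fun t ht => abs_le.2 ht
  have key : ∀ {g g' : ℝ → ℝ} {K : ℝ}, (∀ t, HasDerivAt g (g' t) t) → g 0 = 0 → 0 ≤ K →
      (∀ t ∈ S, |g' t| ≤ K) → ∀ t ∈ S, |g t| ≤ K * |r| := by
    intro g g' K hg h0 hK hb t ht
    have := hSc.norm_image_sub_le_of_norm_hasDerivWithin_le
      (fun z _ => (hg z).hasDerivWithinAt) hb hS0 ht
    rw [h0, sub_zero, sub_zero] at this
    refine this.trans ?_
    gcongr
    exact hSr t ht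
  have g2 := key (g := fun t => f₂ (x + t) - f₂ x) (g' := fun t => f₃ (x + t))
    (fun t => ((h₂ (x + t)).comp_const_add x t).sub_const _) (by simp) hM0
    fun t ht => hM t (hSr t ht)
  have g1 := key (g := fun t => f₁ (x + t) - f₁ x - t * f₂ x) (g' := fun t => f₂ (x + t) - f₂ x)
    (fun t => by
      have := (((h₁ (x + t)).comp_const_add x t).sub_const (f₁ x)).sub
        ((hasDerivAt_id t).mul_const (f₂ x))
      rw [one_mul] at this
      exact this) (by simp) (by positivity) g2
  have g0 := key (g := fun t => f (x + t) - f x - t * f₁ x - t ^ 2 / 2 * f₂ x)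
    (g' := fun t => f₁ (x + t) - f₁ x - t * f₂ x)
    (fun t => by
      have h := ((((h₀ (x + t)).comp_const_add x t).sub_const (f x)).sub
        ((hasDerivAt_id t).mul_const (f₁ x))).sub
        (((hasDerivAt_pow 2 t).div_const 2).mul_const (f₂ x))
      refine h.congr_deriv ?_
      norm_num) (by simp) (by positivity) g1
  refine (g0 r ⟨neg_abs_le r, le_abs_self r⟩).trans_eq ?_
  ring

/-- `tanhPoly c ((1 - X ^ 2) * tanhDeriv c P)` is the derivative of
`tanhPoly c ((1 - X ^ 2) * P)`. -/
def tanhDeriv (c : ℝ) (P : ℝ[X]) : ℝ[X] := C c * derivative ((1 - X ^ 2) * P)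

/-- The function `x ↦ sech²(c x) P(tanh(c x))` as an element of `L²(ℝ)`. -/
def tanhL2 {c : ℝ} (hc : 0 < c) : ℝ[X] →ₗ[ℝ] L2 where
  toFun P := (memLp_tanhPoly hc P).toLp _
  map_add' P Q := by
    rw [← MemLp.toLp_add]
    congr 1
    funext x
    simp [tanhPoly, mul_add]
  map_smul' r P := by
    rw [RingHom.id_apply, ← MemLp.toLp_const_smul]
    congr 1
    funext x
    simp only [tanhPoly, eval_mul, eval_smul, Pi.smul_apply, smul_eq_mul]
    ring

theorem coeFn_tanhL2 {c : ℝ} (hc : 0 < c) (P : ℝ[X]) :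
    tanhL2 hc P =ᵐ[volume] tanhPoly c ((1 - X ^ 2) * P) :=
  MemLp.coeFn_toLp (memLp_tanhPoly hc P)

theorem tanhPoly_one_sub_sq_mul (c : ℝ) (P : ℝ[X]) (x : ℝ) :
    tanhPoly c ((1 - X ^ 2) * P) x
      = (1 - Real.tanh (c * x) ^ 2) * P.eval (Real.tanh (c * x)) := by
  simp [tanhPoly]

theorem coeFn_avgOp {η : ℝ} (hη : η ≠ 0) (V : L2) {f : ℝ → ℝ} (hf : V =ᵐ[volume] f) :
    avgOp η V =ᵐ[volume] avg η f := by
  rw [← opA_eq_avgOp hη]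
  refine (MemLp.coeFn_toLp (memLp_avg η (Lp.memLp V))).trans (ae_of_all _ fun x => ?_)
  rw [avg, avg]
  congr 1
  exact intervalIntegral.integral_congr_ae (hf.mono fun x hx _ => hx)

/-- The remainder keeps the weight `sech²(c x)` and is therefore small in `L²`: the third derivative
at `x + t` is compared with that weight at `x` by `one_sub_sq_tanh_add_le`, with a uniform factor
`exp (2 * c)` since `|t| ≤ s ≤ 1`. -/
theorem abs_avg_sub_taylor_le {c : ℝ} (hc : 0 < c) (P : ℝ[X]) :
    ∃ M : ℝ, 0 ≤ M ∧ ∀ s : ℝ, 0 < s → s ≤ 1 → ∀ x,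
      |avg s (tanhPoly c ((1 - X ^ 2) * P)) x - tanhPoly c ((1 - X ^ 2) * P) x
        - s ^ 2 / 24 * tanhPoly c ((1 - X ^ 2) * tanhDeriv c (tanhDeriv c P)) x|
      ≤ M * s ^ 3 * (1 - Real.tanh (c * x) ^ 2) := by
  obtain ⟨M, hM0, hM⟩ := exists_norm_eval_le (tanhDeriv c (tanhDeriv c (tanhDeriv c P)))
  refine ⟨M * Real.exp (2 * c), by positivity, fun s hs hs1 x => ?_⟩
  set f := tanhPoly c ((1 - X ^ 2) * P) with hf
  set f₁ := tanhPoly c ((1 - X ^ 2) * tanhDeriv c P) with hf1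
  set f₂ := tanhPoly c ((1 - X ^ 2) * tanhDeriv c (tanhDeriv c P)) with hf2
  have hfc : Continuous f := continuous_tanhPoly _ _
  have hsech := one_sub_sq_tanh_nonneg (c * x)
  have hpt : ∀ r ∈ uIoc (-(1 / 2) : ℝ) (1 / 2),
      ‖f (x + s * r) - f x - s * r * f₁ x - (s * r) ^ 2 / 2 * f₂ x‖
        ≤ M * Real.exp (2 * c) * s ^ 3 * (1 - Real.tanh (c * x) ^ 2) := by
    intro r hr
    rw [uIoc_of_le (by norm_num)] at hr
    have hr1 : |r| ≤ 1 := abs_le.2 ⟨by linarith [hr.1], by linarith [hr.2]⟩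
    have hsr : |s * r| ≤ s := by
      rw [abs_mul, abs_of_pos hs]
      exact mul_le_of_le_one_right hs.le hr1
    have h3 := abs_sub_taylor_two_le (x := x) (r := s * r)
      (M := M * Real.exp (2 * c) * (1 - Real.tanh (c * x) ^ 2))
      (hasDerivAt_tanhPoly c ((1 - X ^ 2) * P))
      (hasDerivAt_tanhPoly c ((1 - X ^ 2) * tanhDeriv c P))
      (hasDerivAt_tanhPoly c ((1 - X ^ 2) * tanhDeriv c (tanhDeriv c P))) fun t ht => by
        have e := tanhPoly_one_sub_sq_mul c (tanhDeriv c (tanhDeriv c (tanhDeriv c P))) (x + t)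
        rw [tanhDeriv] at e
        rw [e, abs_mul, abs_of_nonneg (one_sub_sq_tanh_nonneg _), mul_add]
        have h1 := one_sub_sq_tanh_add_le (c * x) (c * t)
        have h2 := hM (c * x + c * t)
        have h4 : Real.exp (2 * |c * t|) ≤ Real.exp (2 * c) := by
          rw [Real.exp_le_exp, abs_mul, abs_of_pos hc]
          nlinarith [ht.trans (hsr.trans hs1)]
        calc _ ≤ (Real.exp (2 * |c * t|) * (1 - Real.tanh (c * x) ^ 2)) * M := by
              gcongr
              exact h2
          _ ≤ (Real.exp (2 * c) * (1 - Real.tanh (c * x) ^ 2)) * M := by gcongr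
          _ = _ := by ring
    refine h3.trans ?_
    have h5 : |s * r| ^ 3 ≤ s ^ 3 := by gcongr
    calc _ ≤ M * Real.exp (2 * c) * (1 - Real.tanh (c * x) ^ 2) * s ^ 3 := by gcongr
      _ = _ := by ring
  -- The linear term is odd in `r`; the quadratic one gives `∫ r² / 2 = 1 / 24`.
  have hint : ∫ r in (-(1 / 2) : ℝ)..(1 / 2),
      (f (x + s * r) - f x - s * r * f₁ x - (s * r) ^ 2 / 2 * f₂ x)
      = avg s f x - f x - s ^ 2 / 24 * f₂ x := by
    rw [avg_eq_integral_unit f hs.ne', intervalIntegral.integral_sub,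
      intervalIntegral.integral_sub, intervalIntegral.integral_sub]
    · have e1 : ∫ r in (-(1 / 2) : ℝ)..(1 / 2), s * r * f₁ x = 0 := by
        rw [intervalIntegral.integral_mul_const, intervalIntegral.integral_const_mul, integral_id]
        norm_num
      have e2 : ∫ r in (-(1 / 2) : ℝ)..(1 / 2), (s * r) ^ 2 / 2 * f₂ x = s ^ 2 / 24 * f₂ x := by
        simp only [mul_pow, mul_div_assoc]
        rw [intervalIntegral.integral_mul_const, intervalIntegral.integral_const_mul,
          intervalIntegral.integral_div, integral_pow]
        push_cast
        ring
      rw [e1, e2, intervalIntegral.integral_const]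
      norm_num
    all_goals
      apply Continuous.intervalIntegrable
      fun_prop
  rw [← hint]
  refine (intervalIntegral.norm_integral_le_of_norm_le_const hpt).trans_eq ?_
  norm_num

theorem norm_avgOp_tanhL2_sub_le {c : ℝ} (hc : 0 < c) (P : ℝ[X]) :
    ∃ M : ℝ, 0 ≤ M ∧ ∀ s : ℝ, 0 < s → s ≤ 1 →
      ‖avgOp s (tanhL2 hc P) - tanhL2 hc P
        - (s ^ 2 / 24) • tanhL2 hc (tanhDeriv c (tanhDeriv c P))‖ ≤ M * s ^ 3 := by
  obtain ⟨M, hM0, hM⟩ := abs_avg_sub_taylor_le hc P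
  refine ⟨M * ‖tanhL2 hc 1‖, by positivity, fun s hs hs1 => ?_⟩
  rw [mul_right_comm]
  refine Lp.norm_le_mul_norm_of_ae_le_mul ?_
  filter_upwards [coeFn_avgOp hs.ne' _ (coeFn_tanhL2 hc P), coeFn_tanhL2 hc P,
    coeFn_tanhL2 hc 1, coeFn_tanhL2 hc (tanhDeriv c (tanhDeriv c P)),
    Lp.coeFn_sub (avgOp s (tanhL2 hc P) - tanhL2 hc P)
      ((s ^ 2 / 24) • tanhL2 hc (tanhDeriv c (tanhDeriv c P))),
    Lp.coeFn_sub (avgOp s (tanhL2 hc P)) (tanhL2 hc P),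
    Lp.coeFn_smul (s ^ 2 / 24) (tanhL2 hc (tanhDeriv c (tanhDeriv c P)))]
    with x h1 h2 h3 h4 h5 h6 h7
  rw [h5, Pi.sub_apply, h6, Pi.sub_apply, h7, Pi.smul_apply, h1, h2, h3, h4, smul_eq_mul,
    tanhPoly_one_sub_sq_mul c 1, eval_one, mul_one,
    Real.norm_of_nonneg (one_sub_sq_tanh_nonneg _)]
  exact hM s hs hs1 x

/-- Write `V - A² V = -((A V - V) + A (A V - V))` and insert `A V - V = (s² / 24) W + E`. The two
copies of `W / 24` produce the limit `-W / 12`. -/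
theorem avgDefect_eq (s : ℝ) (V W : L2) :
    avgDefect s V = -((s ^ 2 / 24) • (W + avgOp s W))
      - ((avgOp s V - V - (s ^ 2 / 24) • W) + avgOp s (avgOp s V - V - (s ^ 2 / 24) • W)) := by
  rw [avgOp_sub, avgOp_sub, avgOp_smul, avgDefect, smul_add]
  abel

theorem norm_smul_avgDefect_add_le {c : ℝ} (hc : 0 < c) (P : ℝ[X]) :
    ∃ M : ℝ, 0 ≤ M ∧ ∀ s : ℝ, 0 < s → s ≤ 1 →
      ‖(s ^ 2)⁻¹ • avgDefect s (tanhL2 hc P)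
        - (-(1 / 12 : ℝ) • tanhL2 hc (tanhDeriv c (tanhDeriv c P)))‖
      ≤ ‖avgOp s (tanhL2 hc (tanhDeriv c (tanhDeriv c P)))
          - tanhL2 hc (tanhDeriv c (tanhDeriv c P))‖ + M * s := by
  obtain ⟨M, hM0, hM⟩ := norm_avgOp_tanhL2_sub_le hc P
  refine ⟨2 * M, by positivity, fun s hs hs1 => ?_⟩
  set V := tanhL2 hc P
  set W := tanhL2 hc (tanhDeriv c (tanhDeriv c P))
  set E := avgOp s V - V - (s ^ 2 / 24) • W with hE
  have hEs := hM s hs hs1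
  have e : (s ^ 2)⁻¹ • avgDefect s V - (-(1 / 12 : ℝ) • W)
      = -((1 / 24 : ℝ) • (avgOp s W - W)) - (s ^ 2)⁻¹ • (E + avgOp s E) := by
    rw [avgDefect_eq s V W, ← hE, smul_sub, smul_neg, smul_smul,
      show (s ^ 2)⁻¹ * (s ^ 2 / 24) = 1 / 24 by field_simp]
    module
  rw [e]
  refine (norm_sub_le _ _).trans (add_le_add ?_ ?_)
  · rw [norm_neg, norm_smul]
    norm_num
    linarith [norm_nonneg (avgOp s W - W)]
  · rw [norm_smul, norm_inv, Real.norm_of_nonneg (sq_nonneg s), inv_mul_le_iff₀ (by positivity)]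
    refine (norm_add_le _ _).trans ?_
    have := norm_avgOp_le s E
    nlinarith

theorem tendsto_smul_avgDefect {c : ℝ} (hc : 0 < c) (P : ℝ[X]) :
    Tendsto (fun s : ℝ => (s ^ 2)⁻¹ • avgDefect s (tanhL2 hc P)) (𝓝[>] 0)
      (𝓝 (-(1 / 12 : ℝ) • tanhL2 hc (tanhDeriv c (tanhDeriv c P)))) := by
  obtain ⟨M, hM0, hM⟩ := norm_smul_avgDefect_add_le hc P
  set W := tanhL2 hc (tanhDeriv c (tanhDeriv c P))
  rw [tendsto_iff_norm_sub_tendsto_zero]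
  have hlim : Tendsto (fun s : ℝ => ‖avgOp s W - W‖ + M * s) (𝓝[>] 0) (𝓝 0) := by
    have hc : Continuous fun s : ℝ => ‖avgOp s W - W‖ + M * s :=
      ((continuous_avgOp continuous_id continuous_const).sub continuous_const).norm.add
        (continuous_const.mul continuous_id)
    have := (hc.tendsto 0).mono_left (nhdsWithin_le_nhds (s := Ioi 0))
    simpa [avgOp_zero_left] using this
  refine squeeze_zero' (Eventually.of_forall fun _ => norm_nonneg _) ?_ hlim
  filter_upwards [Ioc_mem_nhdsGT (zero_lt_one' ℝ)] with s hs
  exact hM s hs.1 hs.2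

/-- Domination for all scales: the expansion covers `s ≤ 1`, and `(s ^ 2)⁻¹ ≤ 1` covers the rest. -/
theorem exists_norm_smul_avgDefect_le {c : ℝ} (hc : 0 < c) (P : ℝ[X]) :
    ∃ M : ℝ, ∀ s : ℝ, 0 < s → ‖(s ^ 2)⁻¹ • avgDefect s (tanhL2 hc P)‖ ≤ M := by
  obtain ⟨M, hM0, hM⟩ := norm_smul_avgDefect_add_le hc P
  set W := tanhL2 hc (tanhDeriv c (tanhDeriv c P))
  refine ⟨3 * ‖W‖ + M + 2 * ‖tanhL2 hc P‖, fun s hs => ?_⟩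
  rcases le_total s 1 with hs1 | hs1
  · have h1 := hM s hs hs1
    have h2 := norm_le_norm_sub_add ((s ^ 2)⁻¹ • avgDefect s (tanhL2 hc P))
      (-(1 / 12 : ℝ) • W)
    have h3 := norm_sub_le (avgOp s W) W
    have h4 := norm_avgOp_le s W
    have h5 : ‖-(1 / 12 : ℝ) • W‖ ≤ ‖W‖ := by
      rw [norm_smul]
      norm_num
      linarith [norm_nonneg W]
    have h6 : M * s ≤ M := mul_le_of_le_one_right hM0 hs1
    linarith [norm_nonneg (tanhL2 hc P)]
  · rw [norm_smul, norm_inv, Real.norm_of_nonneg (sq_nonneg s)]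
    have h1 : (s ^ 2)⁻¹ ≤ 1 := inv_le_one_of_one_le₀ (by nlinarith)
    have h2 := norm_avgDefect_le s (tanhL2 hc P)
    have h3 : (s ^ 2)⁻¹ * ‖avgDefect s (tanhL2 hc P)‖ ≤ ‖avgDefect s (tanhL2 hc P)‖ :=
      mul_le_of_le_one_left (norm_nonneg _) h1
    linarith [norm_nonneg W]

/-! ### Density of the test functions. -/

section Density

variable {c : ℝ} {f : ℝ → ℝ}

/-- Weierstrass approximation of `h` on `[-1, 1]`, where `tanh` takes its values. -/
theorem integral_comp_tanh_mul_eq_zero (hf : Integrable f)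
    (hP : ∀ P : ℝ[X], ∫ x, P.eval (Real.tanh (c * x)) * f x = 0) {h : ℝ → ℝ}
    (hh : Continuous h) : ∫ x, h (Real.tanh (c * x)) * f x = 0 := by
  have ht : Continuous fun x : ℝ => Real.tanh (c * x) := by
    have := continuous_tanhPoly c X
    unfold tanhPoly at this
    simpa using this
  have hmem : ∀ x, Real.tanh x ∈ Icc (-1 : ℝ) 1 := fun x =>
    ⟨(Real.neg_one_lt_tanh x).le, (Real.tanh_lt_one x).le⟩
  have hi : ∀ g : ℝ → ℝ, Continuous g → Integrable fun x => g (Real.tanh (c * x)) * f x := by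
    intro g hg
    obtain ⟨M, hM⟩ := (isCompact_Icc (a := (-1 : ℝ)) (b := 1)).exists_bound_of_continuousOn
      hg.continuousOn
    exact hf.bdd_mul (hg.comp ht).aestronglyMeasurable (ae_of_all _ fun x => hM _ (hmem _))
  refine eq_of_abs_sub_le_all fun δ hδ => ?_
  set I := ∫ x, ‖f x‖ with hI
  have hI0 : 0 ≤ I := integral_nonneg fun _ => norm_nonneg _
  obtain ⟨p, hp⟩ := exists_polynomial_near_of_continuousOn (-1) 1 h hh.continuousOn
    (δ / (I + 1)) (by positivity)
  have e : ∫ x, h (Real.tanh (c * x)) * f x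
      = ∫ x, (h (Real.tanh (c * x)) - p.eval (Real.tanh (c * x))) * f x := by
    simp only [sub_mul]
    rw [integral_sub (hi h hh) (hi _ p.continuous), hP, sub_zero]
  rw [sub_zero, e, ← Real.norm_eq_abs]
  calc _ ≤ ∫ x, δ / (I + 1) * ‖f x‖ := by
        refine norm_integral_le_of_norm_le (hf.norm.const_mul _) (ae_of_all _ fun x => ?_)
        rw [norm_mul]
        gcongr
        rw [Real.norm_eq_abs, abs_sub_comm]
        exact (hp _ (hmem _)).le
    _ = δ * (I / (I + 1)) := by rw [integral_const_mul]; ring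
    _ ≤ δ := mul_le_of_le_one_right hδ.le (by rw [div_le_one (by positivity)]; linarith)

/-- An integrable function is determined by its moments with respect to `tanh(c x)`. -/
theorem ae_eq_zero_of_tanh_moments (hc : 0 < c) (hf : Integrable f)
    (hP : ∀ P : ℝ[X], ∫ x, P.eval (Real.tanh (c * x)) * f x = 0) : f =ᵐ[volume] 0 := by
  have ht : Continuous fun x : ℝ => Real.tanh (c * x) := by
    have := continuous_tanhPoly c X
    unfold tanhPoly at this
    simpa using this
  have hinj : Function.Injective fun x : ℝ => Real.tanh (c * x) :=
    Real.tanh_injective.comp (mul_right_injective₀ hc.ne')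
  refine ae_eq_zero_of_forall_setIntegral_isCompact_eq_zero hf fun K hK => ?_
  set K' := (fun x : ℝ => Real.tanh (c * x)) '' K with hK'
  have hK'c : IsClosed K' := (hK.image ht).isClosed
  have hδ : ∀ n : ℕ, 0 < (1 : ℝ) / (n + 1) := fun n => by positivity
  set h : ℕ → ℝ → ℝ := fun n z => (thickenedIndicator (hδ n) K' z : ℝ) with hh
  have hhc : ∀ n, Continuous (h n) := fun n =>
    NNReal.continuous_coe.comp (thickenedIndicator (hδ n) K').continuous
  have hlim := thickenedIndicator_tendsto_indicator_closure hδ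
    tendsto_one_div_add_atTop_nhds_zero_nat K'
  rw [hK'c.closure_eq, tendsto_pi_nhds] at hlim
  -- Injectivity of `tanh` makes the indicator of `K` a pointwise limit of continuous functions of
  -- `tanh (c * x)`.
  have hlim' : ∀ x, Tendsto (fun n => h n (Real.tanh (c * x)) * f x) atTop
      (𝓝 (K.indicator f x)) := by
    intro x
    have h1 := ((NNReal.continuous_coe.tendsto _).comp (hlim (Real.tanh (c * x)))).mul_const (f x)
    refine (h1.congr fun n => rfl).trans_eq ?_
    congr 1
    by_cases hx : x ∈ K
    · have : Real.tanh (c * x) ∈ K' := mem_image_of_mem _ hx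
      simp [hx, this]
    · have : Real.tanh (c * x) ∉ K' := fun hx' => hx ((hinj.mem_set_image).1 hx')
      simp [hx, this]
  rw [← integral_indicator hK.measurableSet]
  have hT : Tendsto (fun n => ∫ x, h n (Real.tanh (c * x)) * f x) atTop
      (𝓝 (∫ x, K.indicator f x)) := by
    refine tendsto_integral_of_dominated_convergence (fun x => ‖f x‖) (fun n =>
      ((hhc n).comp ht).aestronglyMeasurable.mul hf.aestronglyMeasurable) hf.norm
      (fun n => ae_of_all _ fun x => ?_) (ae_of_all _ hlim')
    rw [norm_mul]
    refine mul_le_of_le_one_left (norm_nonneg _) ?_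
    rw [Real.norm_of_nonneg (NNReal.coe_nonneg _)]
    exact_mod_cast thickenedIndicator_le_one (hδ n) K' _
  simp only [fun n => integral_comp_tanh_mul_eq_zero hf hP (hhc n)] at hT
  exact (tendsto_const_nhds_iff.1 hT).symm

end Density

theorem inner_tanhL2_mul {c : ℝ} (hc : 0 < c) (U : L2) (P : ℝ[X]) :
    inner ℝ (tanhL2 hc ((1 - X ^ 2) * P)) U
      = ∫ x, P.eval (Real.tanh (c * x)) * ((tanhL2 hc (1 - X ^ 2) : ℝ → ℝ) x * (U : ℝ → ℝ) x) := by
  rw [inner_eq_integral_mul]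
  refine integral_congr_ae ?_
  filter_upwards [coeFn_tanhL2 hc ((1 - X ^ 2) * P), coeFn_tanhL2 hc (1 - X ^ 2)] with x h1 h2
  rw [h1, h2, tanhPoly_one_sub_sq_mul, tanhPoly_one_sub_sq_mul, eval_mul]
  ring

/-- The functions `sech⁴(c x) P(tanh(c x))` are dense in `L²(ℝ)`. -/
theorem topologicalClosure_range_tanhL2 {c : ℝ} (hc : 0 < c) :
    (LinearMap.range ((tanhL2 hc).comp (LinearMap.mulLeft ℝ (1 - X ^ 2)))).topologicalClosure
      = ⊤ := by
  rw [Submodule.topologicalClosure_eq_top_iff, Submodule.eq_bot_iff]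
  intro U hU
  rw [Submodule.mem_orthogonal] at hU
  -- An orthogonal `U` makes all `tanh` moments of the integrable function `sech⁴ U` vanish, and
  -- `sech⁴` has no zeros.
  have hint : Integrable fun x => (tanhL2 hc (1 - X ^ 2) : ℝ → ℝ) x * (U : ℝ → ℝ) x :=
    (Lp.memLp _).integrable_mul (Lp.memLp U)
  have h0 := ae_eq_zero_of_tanh_moments hc hint fun P => by
    rw [← inner_tanhL2_mul hc U P]
    exact hU _ ⟨P, rfl⟩
  rw [Lp.eq_zero_iff_ae_eq_zero]
  filter_upwards [h0, coeFn_tanhL2 hc (1 - X ^ 2)] with x h1 h2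
  rw [h2, tanhPoly_one_sub_sq_mul] at h1
  simp only [eval_sub, eval_one, eval_pow, eval_X, Pi.zero_apply, one_sub_sq_tanh] at h1 ⊢
  have := Real.cosh_pos (c * x)
  exact (mul_eq_zero.1 h1).resolve_left (by positivity)

/-- Bounded sequences converge weakly to zero when they do so on a dense subspace. -/
theorem tendsto_inner_of_dense {V : ℕ → L2} {B : ℝ} (hB : ∀ n, ‖V n‖ ≤ B) {K : Submodule ℝ L2}
    (hK : K.topologicalClosure = ⊤)
    (h : ∀ φ ∈ K, Tendsto (fun n => inner ℝ (V n) φ) atTop (𝓝 0)) (φ : L2) :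
    Tendsto (fun n => inner ℝ (V n) φ) atTop (𝓝 0) := by
  have hφ : φ ∈ closure (K : Set L2) := by
    rw [← Submodule.topologicalClosure_coe, hK]; trivial
  have hB0 : 0 ≤ B := (norm_nonneg _).trans (hB 0)
  rw [Metric.tendsto_atTop]
  intro δ hδ
  obtain ⟨ψ, hψ, hd⟩ := Metric.mem_closure_iff.1 hφ (δ / (2 * (B + 1))) (by positivity)
  obtain ⟨N, hN⟩ := Metric.tendsto_atTop.1 (h ψ hψ) (δ / 2) (by positivity)
  refine ⟨N, fun n hn => ?_⟩
  have h1 := hN n hn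
  rw [Real.dist_eq, sub_zero] at h1 ⊢
  have e : inner ℝ (V n) φ = inner ℝ (V n) (φ - ψ) + inner ℝ (V n) ψ := by
    rw [← inner_add_right, sub_add_cancel]
  have h2 : |inner ℝ (V n) (φ - ψ)| ≤ B * (δ / (2 * (B + 1))) := by
    refine (abs_real_inner_le_norm _ _).trans ?_
    rw [dist_eq_norm] at hd
    gcongr
    exact hB n
  have h3 : B * (δ / (2 * (B + 1))) ≤ δ / 2 := by
    rw [mul_div_assoc', div_le_div_iff₀ (by positivity) (by positivity)]
    nlinarith
  rw [e]
  linarith [abs_add_le (inner ℝ (V n) (φ - ψ)) (inner ℝ (V n) ψ)]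

/-! ### The limit operator on test functions and weak convergence. -/

/-- Supplies the moment that the recursion cannot: `limitPoly X = 0`, since `sech² tanh` is
proportional to `W₀'`. -/
theorem inner_tanhL2_odd {c : ℝ} (hc : 0 < c) {V : L2} (hV : V ∈ L2even) :
    inner ℝ V (tanhL2 hc ((1 - X ^ 2) * X)) = 0 := by
  set F : ℝ → ℝ := fun x => (V : ℝ → ℝ) x * tanhPoly c ((1 - X ^ 2) * ((1 - X ^ 2) * X)) x with hF
  have e : inner ℝ V (tanhL2 hc ((1 - X ^ 2) * X)) = ∫ x, F x := by
    rw [inner_eq_integral_mul]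
    refine integral_congr_ae ?_
    filter_upwards [coeFn_tanhL2 hc ((1 - X ^ 2) * X)] with x hx
    rw [hx]
  have e2 : ∫ x, F (-x) = -∫ x, F x := by
    rw [← integral_neg]
    refine integral_congr_ae ?_
    filter_upwards [hV] with x hx
    simp only [hF, hx, tanhPoly, mul_neg, Real.tanh_neg, eval_mul, eval_sub, eval_one, eval_pow,
      eval_X]
    ring
  rw [integral_neg_eq_self F] at e2
  linarith

theorem Admissible.d1_pos {α β : ℝ → ℝ} (h : Admissible α β) : 0 < d1 α :=
  div_pos (by norm_num) (h.alpha_four.integral_natPow_pos 4 (by norm_num))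

theorem Admissible.d2_pos {α β : ℝ → ℝ} (h : Admissible α β) : 0 < d2 α β :=
  div_pos (mul_pos (by norm_num) (h.beta_three.integral_natPow_pos 3 (by norm_num)))
    (h.alpha_four.integral_natPow_pos 4 (by norm_num))

theorem Admissible.rate_pos {α β : ℝ → ℝ} (h : Admissible α β) : 0 < 1 / 2 * √(d1 α) :=
  mul_pos (by norm_num) (Real.sqrt_pos.2 h.d1_pos)

theorem mulOp_avgW0_tanhL2 (α β : ℝ → ℝ) (hc : 0 < 1 / 2 * √(d1 α)) (P : ℝ[X]) :
    mulOp (avgW0 α β 0) (tanhL2 hc P)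
      = (3 * d1 α / (2 * d2 α β)) • tanhL2 hc ((1 - X ^ 2) * P) := by
  apply Lp.ext
  filter_upwards [coeFn_mulOp (avgW0 α β 0) (tanhL2 hc P), coeFn_tanhL2 hc P,
    coeFn_tanhL2 hc ((1 - X ^ 2) * P),
    Lp.coeFn_smul (3 * d1 α / (2 * d2 α β)) (tanhL2 hc ((1 - X ^ 2) * P))] with x h1 h2 h3 h4
  rw [h1, h2, h4, Pi.smul_apply, h3, avgW0_zero_apply, W0_eq_tanhPoly]
  simp only [tanhPoly, eval_mul, eval_sub, eval_one, eval_pow, eval_X, eval_C, smul_eq_mul]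
  ring

/-- The action of the limit operator on `sech² P(tanh)`, up to the factor `-sech⁴ / 4`. -/
def limitPoly (P : ℝ[X]) : ℝ[X] :=
  (1 - X ^ 2) * derivative (derivative P) - 6 * (X * derivative P) + 6 * P

theorem tanhDeriv_tanhDeriv (c : ℝ) (P : ℝ[X]) :
    tanhDeriv c (tanhDeriv c P) = (c ^ 2) • ((1 - X ^ 2) * ((1 - X ^ 2) * derivative (derivative P)
      - 6 * (X * derivative P) - 6 * P) + 4 * P) := by
  simp only [tanhDeriv, smul_eq_C_mul, derivative_mul, derivative_sub, derivative_one,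
    derivative_X_pow, derivative_C, derivative_add, C_pow]
  simp only [Nat.cast_ofNat, map_ofNat, derivative_zero, pow_one, zero_sub, Nat.add_one_sub_one,
    Nat.cast_one, C_1]
  ring

/-- As `c² / d₁ = 1/4`, the term `4 P` of `tanhDeriv_tanhDeriv` cancels `φ` itself, so a factor
`sech⁴` comes out. The wave contributes `3 sech²`, which turns `-6 P` into `-6 P + 12 P = 6 P`. -/
theorem tanhL2_limit {α β : ℝ → ℝ} (h : Admissible α β) (P : ℝ[X]) :
    tanhL2 h.rate_pos P
        - (d1 α)⁻¹ • tanhL2 h.rate_pos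
          (tanhDeriv (1 / 2 * √(d1 α)) (tanhDeriv (1 / 2 * √(d1 α)) P))
        - (2 * (d2 α β / d1 α)) • mulOp (avgW0 α β 0) (tanhL2 h.rate_pos P)
      = -(1 / 4 : ℝ) • tanhL2 h.rate_pos ((1 - X ^ 2) * limitPoly P) := by
  have h1 := h.d1_pos
  have h2 := h.d2_pos
  have e1 : (d1 α)⁻¹ * (1 / 2 * √(d1 α)) ^ 2 = 1 / 4 := by
    rw [mul_pow, Real.sq_sqrt h1.le]
    field_simp
    norm_num
  have e2 : 2 * (d2 α β / d1 α) * (3 * d1 α / (2 * d2 α β)) = 3 := by field_simp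
  rw [mulOp_avgW0_tanhL2, smul_smul, e2, tanhDeriv_tanhDeriv, map_smul, smul_smul, e1,
    ← map_smul, ← map_smul, ← map_smul, ← map_sub, ← map_sub]
  congr 1
  have e3 : (C (1 / 4 : ℝ) : ℝ[X]) * 4 = 1 := by
    rw [← C_ofNat, ← C_mul]
    norm_num
  have e4 : (C (3 : ℝ) : ℝ[X]) = 3 := C_ofNat 3
  simp only [limitPoly, smul_eq_C_mul, C_neg, e4]
  linear_combination (3 * (1 - X ^ 2) * P - P) * e3

theorem limitPoly_one : limitPoly 1 = 6 := by
  simp [limitPoly]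

/-- The coefficient of `X ^ (m + 2)` never vanishes, so the moment `m + 2` is determined by the
moment `m`. -/
theorem limitPoly_X_pow (m : ℕ) :
    limitPoly (X ^ (m + 2)) = ((m + 2) * (m + 1) : ℝ) • X ^ m
      - ((m + 8) * (m + 1) : ℝ) • (X ^ (m + 2) : ℝ[X]) := by
  rw [limitPoly, derivative_X_pow, derivative_C_mul, derivative_X_pow]
  simp only [smul_eq_C_mul, show m + 2 - 1 = m + 1 from rfl, Nat.add_sub_cancel, C_mul, C_add,
    C_ofNat, map_natCast, Nat.cast_add, Nat.cast_ofNat, Nat.cast_one, C_1]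
  ring

section Weak

variable {α β : ℝ → ℝ} {ε : ℕ → ℝ} {V : ℕ → L2} {B : ℝ}

theorem tendsto_inner_limitPoly (h : Admissible α β) (hpos : ∀ n, 0 < ε n)
    (hε : Tendsto ε atTop (𝓝 0)) (hB : ∀ n, ‖V n‖ ≤ B)
    (hL : Tendsto (fun n => ‖opL α β (ε n) (V n)‖) atTop (𝓝 0)) (P : ℝ[X]) :
    Tendsto (fun n => inner ℝ (V n) (tanhL2 h.rate_pos ((1 - X ^ 2) * limitPoly P))) atTop
      (𝓝 0) := by
  set φ := tanhL2 h.rate_pos P with hφ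
  obtain ⟨M, hM⟩ := exists_norm_smul_avgDefect_le h.rate_pos P
  have hlim := (h.tendsto_opB hM (tendsto_smul_avgDefect h.rate_pos P) hpos hε).sub
    (h.tendsto_opM φ hpos hε)
  rw [tanhL2_limit h P] at hlim
  set Ψ := tanhL2 h.rate_pos ((1 - X ^ 2) * limitPoly P)
  have h1 : Tendsto (fun n => inner ℝ (V n) (opL α β (ε n) φ)) atTop (𝓝 0) := by
    refine squeeze_zero_norm (fun n => ?_) (by simpa using hL.mul_const ‖φ‖)
    rw [← h.inner_opL_left (hpos n)]
    exact norm_inner_le_norm _ _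
  have h2 : Tendsto (fun n => inner ℝ (V n) (opL α β (ε n) φ - -(1 / 4 : ℝ) • Ψ)) atTop
      (𝓝 0) := by
    have h3 := (tendsto_iff_norm_sub_tendsto_zero.1 hlim).const_mul B
    rw [mul_zero] at h3
    refine squeeze_zero_norm (fun n => (norm_inner_le_norm _ _).trans ?_) h3
    exact mul_le_mul_of_nonneg_right (hB n) (norm_nonneg _)
  have h4 := (h2.sub h1).const_mul 4
  rw [sub_zero, mul_zero] at h4
  refine h4.congr fun n => ?_
  rw [inner_sub_right, real_inner_smul_right]
  ring

/-- Even powers start from `limitPoly 1 = 6`, odd ones from the evenness of `V n`. -/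
theorem tendsto_inner_tanhL2 (h : Admissible α β) (hpos : ∀ n, 0 < ε n)
    (hε : Tendsto ε atTop (𝓝 0)) (heven : ∀ n, V n ∈ L2even) (hB : ∀ n, ‖V n‖ ≤ B)
    (hL : Tendsto (fun n => ‖opL α β (ε n) (V n)‖) atTop (𝓝 0)) (P : ℝ[X]) :
    Tendsto (fun n => inner ℝ (V n) (tanhL2 h.rate_pos ((1 - X ^ 2) * P))) atTop (𝓝 0) := by
  have hT := tendsto_inner_limitPoly h hpos hε hB hL
  have hmon : ∀ m : ℕ, Tendsto (fun n => inner ℝ (V n)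
      (tanhL2 h.rate_pos ((1 - X ^ 2) * X ^ m))) atTop (𝓝 0) := by
    intro m
    induction m using Nat.twoStepInduction with
    | zero =>
      have h1 := (hT 1).const_mul (1 / 6)
      rw [mul_zero] at h1
      refine h1.congr fun n => ?_
      rw [limitPoly_one, pow_zero, mul_one, show (1 - X ^ 2 : ℝ[X]) * 6 = (6 : ℝ) • (1 - X ^ 2) by
        rw [smul_eq_C_mul, C_ofNat, mul_comm], map_smul, real_inner_smul_right]
      ring
    | one =>
      simp only [pow_one, inner_tanhL2_odd h.rate_pos (heven _)]
      exact tendsto_const_nhds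
    | more m ih _ =>
      have hm : ((m + 8) * (m + 1) : ℝ) ≠ 0 := by positivity
      have h1 := ((ih.const_mul ((m + 2) * (m + 1) : ℝ)).sub (hT (X ^ (m + 2)))).const_mul
        ((m + 8) * (m + 1) : ℝ)⁻¹
      rw [mul_zero, sub_zero, mul_zero] at h1
      refine h1.congr fun n => ?_
      have e : (1 - X ^ 2) * limitPoly (X ^ (m + 2))
          = ((m + 2) * (m + 1) : ℝ) • ((1 - X ^ 2) * X ^ m)
            - ((m + 8) * (m + 1) : ℝ) • ((1 - X ^ 2) * X ^ (m + 2)) := by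
        rw [limitPoly_X_pow, mul_sub, mul_smul_comm, mul_smul_comm]
      rw [e, map_sub, map_smul, map_smul, inner_sub_right, real_inner_smul_right, real_inner_smul_right, sub_sub_cancel,
        inv_mul_cancel_left₀ hm]
  induction P using Polynomial.induction_on' with
  | add P Q hP hQ =>
    have h1 := hP.add hQ
    rw [add_zero] at h1
    refine h1.congr fun n => ?_
    rw [mul_add, map_add, inner_add_right]
  | monomial m a =>
    have h1 := (hmon m).const_mul a
    rw [mul_zero] at h1
    refine h1.congr fun n => ?_
    rw [← C_mul_X_pow_eq_monomial, ← smul_eq_C_mul, mul_smul_comm, map_smul,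
      real_inner_smul_right]

/-- Bounded even sequences with `ℒ_ε V → 0` converge weakly to zero. -/
theorem tendsto_inner_zero (h : Admissible α β) (hpos : ∀ n, 0 < ε n)
    (hε : Tendsto ε atTop (𝓝 0)) (heven : ∀ n, V n ∈ L2even) (hB : ∀ n, ‖V n‖ ≤ B)
    (hL : Tendsto (fun n => ‖opL α β (ε n) (V n)‖) atTop (𝓝 0)) (φ : L2) :
    Tendsto (fun n => inner ℝ (V n) φ) atTop (𝓝 0) := by
  refine tendsto_inner_of_dense hB (topologicalClosure_range_tanhL2 h.rate_pos) ?_ φ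
  rintro _ ⟨P, rfl⟩
  exact tendsto_inner_tanhL2 h hpos hε heven hB hL P

end Weak

/-! ### Energy identity and modulus of continuity. -/

theorem Admissible.norm_sq_add_energy {α β : ℝ → ℝ} (h : Admissible α β) {ε : ℝ} (hε : 0 < ε)
    (V : L2) :
    ‖V‖ ^ 2 + ∫ ξ in Ioi (0 : ℝ), (α ξ * ξ ^ 2 / ε ^ 2) * (‖V‖ ^ 2 - ‖avgOp (ε * ξ) V‖ ^ 2)
      = inner ℝ V (opL α β ε V) + inner ℝ V (opM α β ε V) := by
  rw [← inner_add_right, opL, sub_add_cancel, h.inner_opB hε, real_inner_self_eq_norm_sq]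
  simp only [inner_avgDefect_self]

theorem sq_norm_sub_sq_norm_avgOp_nonneg (η : ℝ) (V : L2) :
    0 ≤ ‖V‖ ^ 2 - ‖avgOp η V‖ ^ 2 := by
  have := norm_avgOp_le η V
  nlinarith [norm_nonneg (avgOp η V)]

theorem Admissible.energy_integrand_nonneg {α β : ℝ → ℝ} (h : Admissible α β) (ε : ℝ) (V : L2)
    {ξ : ℝ} (hξ : 0 < ξ) :
    0 ≤ (α ξ * ξ ^ 2 / ε ^ 2) * (‖V‖ ^ 2 - ‖avgOp (ε * ξ) V‖ ^ 2) :=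
  mul_nonneg (div_nonneg (mul_nonneg (h.alpha_nonneg ξ hξ) (sq_nonneg ξ)) (sq_nonneg ε))
    (sq_norm_sub_sq_norm_avgOp_nonneg _ V)

theorem Admissible.energy_nonneg {α β : ℝ → ℝ} (h : Admissible α β) (ε : ℝ) (V : L2) :
    0 ≤ ∫ ξ in Ioi (0 : ℝ), (α ξ * ξ ^ 2 / ε ^ 2) * (‖V‖ ^ 2 - ‖avgOp (ε * ξ) V‖ ^ 2) :=
  setIntegral_nonneg measurableSet_Ioi fun _ hξ => h.energy_integrand_nonneg ε V hξ

/-- Keeps some mass of `α ξ²` away from `0`, so that windows of width at least `ε a` enter the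
energy. -/
theorem exists_pos_setIntegral_Ioi {f : ℝ → ℝ} (hf : IntegrableOn f (Ioi 0))
    (h : 0 < ∫ ξ in Ioi (0 : ℝ), f ξ) : ∃ a : ℝ, 0 < a ∧ 0 < ∫ ξ in Ioi a, f ξ := by
  have hU : ⋃ n : ℕ, Ioi ((1 : ℝ) / (n + 1)) = Ioi 0 := by
    ext x
    simp only [mem_iUnion, mem_Ioi]
    refine ⟨fun ⟨n, hn⟩ => lt_trans (by positivity) hn, fun hx => exists_nat_one_div_lt hx⟩
  have hlim : Tendsto (fun n : ℕ => ∫ ξ in Ioi ((1 : ℝ) / (n + 1)), f ξ) atTop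
      (𝓝 (∫ ξ in ⋃ n : ℕ, Ioi ((1 : ℝ) / (n + 1)), f ξ)) := by
    refine tendsto_setIntegral_of_monotone (fun _ => measurableSet_Ioi) (fun m n hmn => ?_)
      (hU ▸ hf)
    exact Ioi_subset_Ioi (Nat.one_div_le_one_div hmn)
  rw [hU] at hlim
  obtain ⟨n, hn⟩ := (hlim.eventually_const_lt h).exists
  exact ⟨_, by positivity, hn⟩

/-- For `ξ > a` the shift `u` is at most half the window `ε ξ`, and `sq_norm_trans_sub_le` applies
under the integral. -/
theorem Admissible.sq_norm_trans_sub_le_energy {α β : ℝ → ℝ} (h : Admissible α β) {ε a u : ℝ}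
    (hε : 0 < ε) (ha : 0 < a) (hu : 0 ≤ u) (hua : u ≤ ε * a / 2) (V : L2) :
    (∫ ξ in Ioi a, α ξ * ξ ^ 2) * (‖trans u V - V‖ ^ 2 / (8 * ε ^ 2))
      ≤ ∫ ξ in Ioi (0 : ℝ), (α ξ * ξ ^ 2 / ε ^ 2) * (‖V‖ ^ 2 - ‖avgOp (ε * ξ) V‖ ^ 2) := by
  have hsub : Ioi a ⊆ Ioi (0 : ℝ) := Ioi_subset_Ioi ha.le
  have hi : IntegrableOn (fun ξ => (α ξ * ξ ^ 2 / ε ^ 2) * (‖V‖ ^ 2 - ‖avgOp (ε * ξ) V‖ ^ 2))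
      (Ioi 0) := by
    have := (h.integrableOn_avgDefect ε V).const_inner (𝕜 := ℝ) V
    simp only [real_inner_smul_right, inner_avgDefect_self] at this
    exact this
  refine le_trans ?_ (setIntegral_mono_set hi ?_ hsub.eventuallyLE)
  · rw [← integral_mul_const]
    refine setIntegral_mono_on ((h.integrableOn_alpha_two.mono_set hsub).mul_const _)
      (hi.mono_set hsub) measurableSet_Ioi fun ξ hξ => ?_
    have hξ0 : 0 < ξ := ha.trans hξ
    have h1 : u ≤ ε * ξ / 2 := hua.trans (by gcongr; exact le_of_lt hξ)
    have h2 := sq_norm_trans_sub_le (mul_pos hε hξ0) hu h1 V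
    have h3 : 0 ≤ α ξ * ξ ^ 2 := mul_nonneg (h.alpha_nonneg ξ hξ0) (sq_nonneg ξ)
    rw [div_mul_eq_mul_div, mul_div_assoc]
    refine mul_le_mul_of_nonneg_left ?_ h3
    rw [← div_div]
    gcongr
    linarith
  · filter_upwards [ae_restrict_mem measurableSet_Ioi] with ξ hξ
    exact h.energy_integrand_nonneg ε V hξ

/-- A bound for `V` and `ℒ_ε V` yields a modulus of continuity for the translates of `V`. -/
theorem Admissible.exists_norm_trans_sub_le {α β : ℝ → ℝ} (h : Admissible α β) (B B' : ℝ) :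
    ∃ M : ℝ, 0 ≤ M ∧ ∀ ε : ℝ, 0 < ε → ∀ V : L2, ‖V‖ ≤ B → ‖opL α β ε V‖ ≤ B' →
      ∀ u : ℝ, ‖trans u V - V‖ ≤ M * (|u| + ε) := by
  obtain ⟨a, ha, hm⟩ := exists_pos_setIntegral_Ioi h.integrableOn_alpha_two
    (h.alpha_two.integral_natPow_pos 2 (by norm_num))
  set m := ∫ ξ in Ioi a, α ξ * ξ ^ 2
  set K := 2 * (|3 * d1 α / (2 * d2 α β)| * ∫ ξ in Ioi (0 : ℝ), β ξ * ξ ^ 3) with hK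
  have hK0 : 0 ≤ K := by
    have := h.beta_three.integral_natPow_pos 3 (by norm_num)
    positivity
  set E := |B| * |B'| + K * |B| ^ 2
  have hE : 0 ≤ E := by positivity
  -- `√(8 E / m)` solves `m ‖trans u V - V‖² / (8 ε²) ≤ E` for short shifts; `2 / a + 1` accounts
  -- for the number of short steps.
  refine ⟨√(8 * E / m) * (2 / a + 1), by positivity, fun ε hε V hV hLV => ?_⟩
  have hV' : ‖V‖ ≤ |B| := hV.trans (le_abs_self B)
  have henergy : ∫ ξ in Ioi (0 : ℝ), (α ξ * ξ ^ 2 / ε ^ 2) * (‖V‖ ^ 2 - ‖avgOp (ε * ξ) V‖ ^ 2)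
      ≤ E := by
    have h1 := h.norm_sq_add_energy hε V
    have h2 : inner ℝ V (opL α β ε V) ≤ |B| * |B'| := by
      refine (real_inner_le_norm _ _).trans ?_
      gcongr
      exact hLV.trans (le_abs_self B')
    have h3 : inner ℝ V (opM α β ε V) ≤ K * |B| ^ 2 := by
      refine (le_abs_self _).trans ((h.abs_inner_opM_le hε V).trans ?_)
      gcongr
    nlinarith [sq_nonneg ‖V‖]
  have hsmall : ∀ u : ℝ, 0 ≤ u → u ≤ ε * a / 2 → ‖trans u V - V‖ ≤ √(8 * E / m) * ε := by
    intro u hu hua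
    have h1 := (h.sq_norm_trans_sub_le_energy hε ha hu hua V).trans henergy
    rw [← mul_div_assoc, div_le_iff₀ (by positivity)] at h1
    refine abs_le_of_sq_le_sq' ?_ (by positivity) |>.2
    rw [mul_pow, Real.sq_sqrt (by positivity), div_mul_eq_mul_div, le_div_iff₀ hm]
    linarith
  have hpos : ∀ u : ℝ, 0 ≤ u → ‖trans u V - V‖ ≤ √(8 * E / m) * (2 / a + 1) * (u + ε) := by
    intro u hu
    rcases hu.eq_or_lt with rfl | hu
    · rw [trans_zero, sub_self, norm_zero]
      positivity
    -- The least number of equal steps for which each has length at most `ε a / 2`.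
    set k := ⌈2 * u / (ε * a)⌉₊
    have hk1 : 2 * u / (ε * a) ≤ k := Nat.le_ceil _
    have hk2 : (k : ℝ) < 2 * u / (ε * a) + 1 := Nat.ceil_lt_add_one (by positivity)
    have hk0 : (0 : ℝ) < k := lt_of_lt_of_le (by positivity) hk1
    have h1 : u / k ≤ ε * a / 2 := by
      rw [div_le_iff₀ (by positivity)] at hk1 ⊢
      linarith
    have h2 := norm_trans_nat_mul_sub_le k (u / k) V
    rw [mul_div_cancel₀ _ hk0.ne'] at h2
    refine h2.trans ?_
    have h3 := hsmall (u / k) (by positivity) h1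
    calc _ ≤ (2 * u / (ε * a) + 1) * (√(8 * E / m) * ε) := by gcongr
      _ = √(8 * E / m) * (2 / a * u + ε) := by field_simp
      _ ≤ √(8 * E / m) * ((2 / a + 1) * (u + ε)) := by
        have : 0 ≤ 2 / a * ε := by positivity
        gcongr
        linarith
      _ = _ := by ring
  intro u
  rcases le_total 0 u with hu | hu
  · rw [abs_of_nonneg hu]
    exact hpos u hu
  · rw [abs_of_nonpos hu, ← norm_trans_neg_sub]
    exact hpos (-u) (by linarith)

/-! ### Compactness supplied by the decaying wave. -/

/-- Point values of an average are weakly continuous functionals, so averages of a weakly null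
sequence tend to zero pointwise. -/
theorem avg_eq_inner {η : ℝ} (hη : 0 < η) (V : L2) (x : ℝ) :
    avg η V x = η⁻¹ * inner ℝ (indicatorConstLp 2
      (measurableSet_Ioc (a := x - η / 2) (b := x + η / 2)) measure_Ioc_lt_top.ne (1 : ℝ)) V := by
  rw [L2.inner_indicatorConstLp_one, avg, intervalIntegral.integral_of_le (by linarith)]

theorem abs_avg_le {η : ℝ} (hη : 0 < η) (V : L2) (x : ℝ) :
    |avg η V x| ≤ η⁻¹ * (√η * ‖V‖) := by
  rw [avg_eq_inner hη, abs_mul, abs_of_pos (inv_pos.2 hη)]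
  gcongr
  refine (abs_real_inner_le_norm _ _).trans_eq ?_
  congr 1
  rw [norm_indicatorConstLp (by norm_num) (by norm_num), measureReal_def, Real.volume_Ioc,
    ENNReal.toReal_ofReal (by linarith), norm_one, one_mul, Real.sqrt_eq_rpow]
  norm_num

section Compactness

variable {α β : ℝ → ℝ} {ε : ℕ → ℝ} {V : ℕ → L2} {B : ℝ}

/-- `V ↦ W₀ 𝒜_η V` maps weak null sequences to null sequences. -/
theorem tendsto_norm_mulOp_avgOp (h : Admissible α β) (hB : ∀ n, ‖V n‖ ≤ B)
    (hweak : ∀ φ : L2, Tendsto (fun n => inner ℝ (V n) φ) atTop (𝓝 0)) {η : ℝ} (hη : 0 < η) :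
    Tendsto (fun n => ‖mulOp (avgW0 α β 0) (avgOp η (V n))‖) atTop (𝓝 0) := by
  have hsq : ∀ n, ‖mulOp (avgW0 α β 0) (avgOp η (V n))‖ ^ 2
      = ∫ x, W0 α β x ^ 2 * avg η (V n) x ^ 2 := by
    intro n
    rw [← real_inner_self_eq_norm_sq, inner_eq_integral_mul]
    refine integral_congr_ae ?_
    filter_upwards [coeFn_mulOp (avgW0 α β 0) (avgOp η (V n)),
      coeFn_avgOp hη.ne' (V n) (ae_eq_refl _)] with x h1 h2
    rw [h1, h2, avgW0_zero_apply]
    ring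
  have hW : Integrable fun x => W0 α β x ^ 2 := by
    rw [W0_eq_tanhPoly, mul_comm (C _)]
    exact (memLp_tanhPoly h.rate_pos _).integrable_sq
  have hlim : Tendsto (fun n => ∫ x, W0 α β x ^ 2 * avg η (V n) x ^ 2) atTop
      (𝓝 (∫ _ : ℝ, (0 : ℝ))) := by
    -- The uniform bound `abs_avg_le` leaves the integrable majorant `W₀²` up to a constant.
    refine tendsto_integral_of_dominated_convergence
      (fun x => W0 α β x ^ 2 * (η⁻¹ * (√η * B)) ^ 2) (fun n => ?_) (hW.mul_const _)
      (fun n => ae_of_all _ fun x => ?_) (ae_of_all _ fun x => ?_)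
    · have hc := continuous_avg η ((Lp.memLp (V n)).locallyIntegrable (by norm_num))
      exact (((continuous_W0 α β).pow 2).mul (hc.pow 2)).aestronglyMeasurable
    · rw [Real.norm_of_nonneg (by positivity), ← sq_abs (avg η (V n) x)]
      have := abs_avg_le hη (V n) x
      gcongr
      refine this.trans ?_
      gcongr
      exact hB n
    · have h1 : Tendsto (fun n => avg η (V n) x) atTop (𝓝 0) := by
        simp only [avg_eq_inner hη]
        have := (hweak (indicatorConstLp 2
          (measurableSet_Ioc (a := x - η / 2) (b := x + η / 2)) measure_Ioc_lt_top.ne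
          (1 : ℝ))).const_mul η⁻¹
        rw [mul_zero] at this
        exact this.congr fun n => by rw [real_inner_comm]
      simpa using (h1.pow 2).const_mul (W0 α β x ^ 2)
  rw [integral_zero] at hlim
  have h2 := (hlim.congr fun n => (hsq n).symm).sqrt
  simpa only [Real.sqrt_sq (norm_nonneg _), Real.sqrt_zero] using h2

theorem norm_mulOp_avgW0_le (α β : ℝ → ℝ) (η : ℝ) (V : L2) :
    ‖mulOp (avgW0 α β η) V‖ ≤ |3 * d1 α / (2 * d2 α β)| * ‖V‖ :=
  (norm_mulOp_le _ _).trans (by gcongr; exact norm_avgW0_le α β η)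

theorem norm_avgOp_sub_self_le_of_modulus {M ε : ℝ} {V : L2} (hM : 0 ≤ M)
    (h : ∀ u : ℝ, ‖trans u V - V‖ ≤ M * (|u| + ε)) {η : ℝ} (hη : 0 ≤ η) :
    ‖avgOp η V - V‖ ≤ M * (η + ε) := by
  refine norm_avgOp_sub_self_le V fun u hu => (h u).trans ?_
  rw [abs_of_nonneg hη] at hu
  gcongr
  linarith

/-- Replacing `V n` by its average at scale `η` costs `O(η + ε n)`; `η` is fixed before `n → ∞`. -/
theorem tendsto_norm_mulOp (h : Admissible α β) (hε : Tendsto ε atTop (𝓝 0))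
    (hB : ∀ n, ‖V n‖ ≤ B) (hweak : ∀ φ : L2, Tendsto (fun n => inner ℝ (V n) φ) atTop (𝓝 0))
    {M : ℝ} (hM0 : 0 ≤ M) (hM : ∀ n (u : ℝ), ‖trans u (V n) - V n‖ ≤ M * (|u| + ε n)) :
    Tendsto (fun n => ‖mulOp (avgW0 α β 0) (V n)‖) atTop (𝓝 0) := by
  set K := |3 * d1 α / (2 * d2 α β)|
  have hK : 0 ≤ K := abs_nonneg _
  have hbound : ∀ η : ℝ, 0 < η → ∀ n, ‖mulOp (avgW0 α β 0) (V n)‖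
      ≤ ‖mulOp (avgW0 α β 0) (avgOp η (V n))‖ + K * (M * (η + ε n)) := by
    intro η hη n
    have e : V n = avgOp η (V n) - (avgOp η (V n) - V n) := by abel
    conv_lhs => rw [e, map_sub]
    refine (norm_sub_le _ _).trans (add_le_add_right ((norm_mulOp_avgW0_le α β 0 _).trans ?_) _)
    gcongr
    exact norm_avgOp_sub_self_le_of_modulus hM0 (hM n) hη.le
  rw [Metric.tendsto_nhds]
  intro δ hδ
  -- Makes `K * M * η < δ`; the added `1` guards against `K * M = 0`.
  set η := δ / (2 * (K * M + 1))
  have hη : 0 < η := by positivity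
  have hlim : Tendsto (fun n => ‖mulOp (avgW0 α β 0) (avgOp η (V n))‖ + K * (M * (η + ε n)))
      atTop (𝓝 (0 + K * (M * (η + 0)))) :=
    (tendsto_norm_mulOp_avgOp h hB hweak hη).add (((hε.const_add η).const_mul M).const_mul K)
  have hlt : 0 + K * (M * (η + 0)) < δ := by
    have h1 : (K * M + 1) * η = δ / 2 := by
      simp only [η]
      field_simp
    nlinarith
  filter_upwards [hlim.eventually_lt_const hlt] with n hn
  rw [Real.dist_eq, sub_zero, abs_of_nonneg (norm_nonneg _)]
  exact (hbound η hη n).trans_lt hn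

theorem tendsto_inner_opM (h : Admissible α β) (hpos : ∀ n, 0 < ε n)
    (hε : Tendsto ε atTop (𝓝 0)) (hB : ∀ n, ‖V n‖ ≤ B)
    (hmul : Tendsto (fun n => ‖mulOp (avgW0 α β 0) (V n)‖) atTop (𝓝 0))
    {M : ℝ} (hM0 : 0 ≤ M) (hM : ∀ n (u : ℝ), ‖trans u (V n) - V n‖ ≤ M * (|u| + ε n)) :
    Tendsto (fun n => inner ℝ (V n) (opM α β (ε n) (V n))) atTop (𝓝 0) := by
  set K := |3 * d1 α / (2 * d2 α β)| with hKdef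
  have hK : 0 ≤ K := abs_nonneg _
  have hB0 : 0 ≤ B := (norm_nonneg _).trans (hB 0)
  have hpt : ∀ ξ : ℝ, 0 < ξ →
      Tendsto (fun n => inner ℝ (V n) (avgMul α β (ε n * ξ) (V n))) atTop (𝓝 0) := by
    intro ξ hξ
    have hη : Tendsto (fun n => ε n * ξ) atTop (𝓝 0) := by simpa using hε.mul_const ξ
    have hw : Tendsto (fun n => ‖avgW0 α β (ε n * ξ) - avgW0 α β 0‖) atTop (𝓝 0) :=
      tendsto_iff_norm_sub_tendsto_zero.1 (((continuous_avgW0 α β).tendsto 0).comp hη)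
    have hlim : Tendsto (fun n => B * (‖avgW0 α β (ε n * ξ) - avgW0 α β 0‖ * B
        + K * (M * (ε n * ξ + ε n)) + ‖mulOp (avgW0 α β 0) (V n)‖)) atTop
        (𝓝 (B * (0 * B + K * (M * (0 + 0)) + 0))) :=
      (((hw.mul_const B).add (((hη.add hε).const_mul M).const_mul K)).add hmul).const_mul B
    simp only [zero_mul, add_zero, mul_zero] at hlim
    refine squeeze_zero_norm (fun n => ?_) hlim
    rw [avgMul, ← inner_avgOp_left]
    refine (norm_inner_le_norm _ _).trans ?_
    set A := avgOp (ε n * ξ) (V n) with hA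
    have hAB : ‖A‖ ≤ B := (norm_avgOp_le _ _).trans (hB n)
    -- The three errors come from averaging the wave, from averaging `V n`, and from `W₀ V n`
    -- itself.
    have e : mulOp (avgW0 α β (ε n * ξ)) A = mulOp (avgW0 α β (ε n * ξ) - avgW0 α β 0) A
        + mulOp (avgW0 α β 0) (A - V n) + mulOp (avgW0 α β 0) (V n) := by
      rw [map_sub, map_sub, sub_apply]
      abel
    have hn : ‖mulOp (avgW0 α β (ε n * ξ)) A‖ ≤ ‖avgW0 α β (ε n * ξ) - avgW0 α β 0‖ * B
        + K * (M * (ε n * ξ + ε n)) + ‖mulOp (avgW0 α β 0) (V n)‖ := by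
      rw [e]
      refine (norm_add₃_le).trans ?_
      gcongr
      · refine (norm_mulOp_le _ _).trans ?_
        gcongr
      · refine (norm_mulOp_avgW0_le α β 0 _).trans ?_
        gcongr
        exact norm_avgOp_sub_self_le_of_modulus hM0 (hM n) (mul_pos (hpos n) hξ).le
    gcongr
  have hint : Tendsto (fun n => ∫ ξ in Ioi (0 : ℝ),
      (β ξ * ξ ^ 3) * inner ℝ (V n) (avgMul α β (ε n * ξ) (V n))) atTop
      (𝓝 (∫ _ in Ioi (0 : ℝ), (0 : ℝ))) := by
    refine tendsto_integral_of_dominated_convergence (fun ξ => ‖β ξ * ξ ^ 3‖ * (B * (K * B)))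
      (fun n => ?_) (h.integrableOn_beta_three.norm.mul_const _) (fun n => ?_) ?_
    · have := (h.integrableOn_avgMul (ε n) (V n)).const_inner (𝕜 := ℝ) (V n)
      simp only [real_inner_smul_right] at this
      exact this.aestronglyMeasurable
    · refine ae_of_all _ fun ξ => ?_
      rw [norm_mul]
      gcongr
      refine (norm_inner_le_norm _ _).trans ?_
      have h1 := norm_avgMul_le α β (ε n * ξ) (V n)
      rw [← hKdef] at h1
      have h2 := hB n
      gcongr
      exact h1.trans (by gcongr)
    · filter_upwards [ae_restrict_mem measurableSet_Ioi] with ξ hξ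
      simpa using (hpt ξ hξ).const_mul (β ξ * ξ ^ 3)
  rw [integral_zero] at hint
  have h2 := hint.const_mul 2
  rw [mul_zero] at h2
  exact h2.congr fun n => (h.inner_opM (hpos n) (V n) (V n)).symm

end Compactness

end Peridynamic

end

theorem mainTheorem4 (α β : ℝ → ℝ) (hαβ : Peridynamic.Admissible α β)
    (ε : ℕ → ℝ) (hε_pos : ∀ n, 0 < ε n) (hε : Tendsto ε atTop (𝓝 0))
    (V : ℕ → Peridynamic.L2) (hV_even : ∀ n, V n ∈ Peridynamic.L2even)
    (hV_bdd : ∃ C : ℝ, ∀ n, ‖V n‖ ≤ C)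
    (hL : Tendsto (fun n => ‖Peridynamic.opL α β (ε n) (V n)‖) atTop (𝓝 0)) :
    Tendsto (fun n => ‖V n‖) atTop (𝓝 0) := by
  obtain ⟨B, hB⟩ := hV_bdd
  obtain ⟨B', hB'⟩ := hL.bddAbove_range
  obtain ⟨M, hM0, hM⟩ := hαβ.exists_norm_trans_sub_le B B'
  have hmod : ∀ n (u : ℝ), ‖Peridynamic.trans u (V n) - V n‖ ≤ M * (|u| + ε n) := fun n =>
    hM (ε n) (hε_pos n) (V n) (hB n) (hB' (mem_range_self n))
  have hweak := Peridynamic.tendsto_inner_zero hαβ hε_pos hε hV_even hB hL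
  have hmul := Peridynamic.tendsto_norm_mulOp hαβ hε hB hweak hM0 hmod
  have hinnerM := Peridynamic.tendsto_inner_opM hαβ hε_pos hε hB hmul hM0 hmod
  have hlim := (hL.const_mul B).add hinnerM
  rw [mul_zero, add_zero] at hlim
  have hsq : Tendsto (fun n => ‖V n‖ ^ 2) atTop (𝓝 0) := by
    refine squeeze_zero (fun n => sq_nonneg _) (fun n => ?_) hlim
    -- Dropping the nonnegative energy leaves `‖V n‖² ≤ ⟨V n, opL V n⟩ + ⟨V n, opM V n⟩`.
    have h1 := hαβ.norm_sq_add_energy (hε_pos n) (V n)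
    have h2 := hαβ.energy_nonneg (ε n) (V n)
    have h3 : inner ℝ (V n) (Peridynamic.opL α β (ε n) (V n))
        ≤ B * ‖Peridynamic.opL α β (ε n) (V n)‖ :=
      (real_inner_le_norm _ _).trans (mul_le_mul_of_nonneg_right (hB n) (norm_nonneg _))
    linarith
  have := hsq.sqrt
  simpa only [Real.sqrt_sq (norm_nonneg _), Real.sqrt_zero] using this
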